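/- Let $k\ge 0$ and let $M$ be a closed topological $k$-manifold, i.e. a compact Hausdorff space in which every point has an open neighbourhood homeomorphic to an open subset of $\mathbb{R}^k$ ($M$ need not be connected). An action of a group $G$ on $M$ by homeomorphisms is a homomorphism $\rho\colon G\to\mathrm{Homeo}(M)$; it is trivial if $\rho(g)=\mathrm{id}_M$ for all $g\in G$, and homologically trivial if every $\rho(g)$ induces the identity on the singular homology $H_i(M;\mathbb{Z})$ for every $i\ge 0$. For $n\geq 1$ let $F_n$ be the free group of rank $n$, and let $\mathrm{SAut}(F_n)\le\mathrm{Aut}(F_n)$ be the subgroup of the automorphisms whose induced action on the abelianization $\mathbb{Z}^n$ of $F_n$ has determinant $1$. Suppose that $M$ satisfies the conjecture that homologically trivial actions are trivial in dimension less than $n-1$, either for the groups $\mathrm{SAut}(F_n)$ or for the groups $\mathrm{SL}_n(\mathbb{Z})$; that is, suppose that at least one of the following holds: (a) for every $n>k+1$, every homologically trivial action of $\mathrm{SAut}(F_n)$ on $M$ by homeomorphisms is trivial; (b) for every $n>k+1$, every homologically trivial action of $\mathrm{SL}_n(\mathbb{Z})$ on $M$ by homeomorphisms is trivial. Then, for every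 $n>k+1$, every action of $\mathrm{SL}_n(\mathbb{Q})$ on $M$ by homeomorphisms is trivial. -/

import Mathlib

universe u

noncomputable section

open CategoryTheory

/-- The homomorphism `F_n → ℤ` (written multiplicatively) which takes a word to the sum of the
exponents of the generator `x_i` in it, i.e. the `i`-th coordinate of the abelianization map
`F_n → ℤⁿ`. -/
def exponentSum (n : ℕ) (i : Fin n) : FreeGroup (Fin n) →* Multiplicative ℤ :=
  FreeGroup.lift fun j => Multiplicative.ofAdd (if i = j then 1 else 0)

/-- The matrix of the endomorphism of `ℤⁿ` that an endomorphism `f` of `F_n` induces on the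
abelianization: its `j`-th column is the class of `f x_j`. -/
def abelianizationMatrix (n : ℕ) (f : FreeGroup (Fin n) →* FreeGroup (Fin n)) :
    Matrix (Fin n) (Fin n) ℤ :=
  Matrix.of fun i j => (exponentSum n i (f (FreeGroup.of j))).toAdd

theorem toAdd_exponentSum_map (n : ℕ) (f : FreeGroup (Fin n) →* FreeGroup (Fin n)) (i : Fin n)
    (w : FreeGroup (Fin n)) :
    (exponentSum n i (f w)).toAdd =
      ∑ j, abelianizationMatrix n f i j * (exponentSum n j w).toAdd := by
  induction w using FreeGroup.induction_on with
  | C1 => simp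
  | of x => simp [exponentSum, abelianizationMatrix]
  | inv_of x h => simp [h]
  | mul x y hx hy => simp [hx, hy, mul_add, Finset.sum_add_distrib]

/-- The action of `Aut(F_n)` on the abelianization `ℤⁿ` of `F_n`, in terms of matrices. -/
def autAbelianization (n : ℕ) : MulAut (FreeGroup (Fin n)) →* Matrix (Fin n) (Fin n) ℤ where
  toFun φ := abelianizationMatrix n φ.toMonoidHom
  map_one' := by
    ext i j
    simp [abelianizationMatrix, exponentSum, Matrix.one_apply]
  map_mul' φ ψ := by
    ext i j
    exact toAdd_exponentSum_map n φ.toMonoidHom i (ψ (FreeGroup.of j))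

/-- `SAut(F_n)`: the automorphisms of `F_n` whose action on the abelianization `ℤⁿ` has
determinant `1`. -/
def SAut (n : ℕ) : Subgroup (MulAut (FreeGroup (Fin n))) :=
  (Matrix.detMonoidHom.comp (autAbelianization n)).ker

/-- A homeomorphism of `M` that induces the identity on the singular homology `H_i(M; ℤ)` for
every `i`. (The coefficients `ℤ` are lifted to the universe of `M`.) -/
def HomologicallyTrivial {M : Type u} [TopologicalSpace M] (f : M ≃ₜ M) : Prop :=
  ∀ i : ℕ,
    (((AlgebraicTopology.singularHomologyFunctor (ModuleCat.{u} ℤ) i).obj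
      (ModuleCat.of ℤ (ULift.{u} ℤ))).map (TopCat.ofHom (f : C(M, M)))) = 𝟙 _

/-- An action of a group by homeomorphisms, `ρ : G →* (M ≃ₜ M)`, is trivial if every group
element fixes every point. -/
def IsTrivialAction {G : Type*} [Group G] {M : Type*} [TopologicalSpace M]
    (ρ : G →* (M ≃ₜ M)) : Prop :=
  ∀ (g : G) (x : M), ρ g x = x

/-- Every homologically trivial action of `G` on `M` by homeomorphisms is trivial. -/
def HomologicallyTrivialActionsAreTrivial (G : Type*) [Group G] (M : Type u)
    [TopologicalSpace M] : Prop :=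
  ∀ ρ : G →* (M ≃ₜ M), (∀ g : G, HomologicallyTrivial (ρ g)) → IsTrivialAction ρ

/-- The conjecture for the `k`-manifold `M`, for the groups `SAut(F_n)`, `n > k + 1`. -/
def ConjectureSAut (k : ℕ) (M : Type u) [TopologicalSpace M] : Prop :=
  ∀ n : ℕ, k + 1 < n → HomologicallyTrivialActionsAreTrivial (SAut n) M

/-- The conjecture for the `k`-manifold `M`, for the groups `SL_n(ℤ)`, `n > k + 1`. -/
def ConjectureSLZ (k : ℕ) (M : Type u) [TopologicalSpace M] : Prop :=
  ∀ n : ℕ, k + 1 < n →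
    HomologicallyTrivialActionsAreTrivial (Matrix.SpecialLinearGroup (Fin n) ℤ) M

end

/-!
# Actions of `SL_n(ℚ)` on compact manifolds

The singular homology of a compact topological manifold is finitely generated (barycentric
subdivision and a Mayer–Vietoris argument), so that `SL_n(ℚ)`, which is generated by divisible
elements, acts trivially on it.
-/

noncomputable section

open CategoryTheory

/-! The group `SL_n(ℚ)` is generated by its one-parameter groups of transvections, each a copy of
the additive group `ℚ`. On a finitely generated abelian group `A` the group `ℚ` can only act
trivially: for `m ≠ 0` it acts on the finite group `A / mA` through a finite group, hence trivially
because `ℚ` is divisible, and an element of `A` lying in every `mA` is zero (`rat_action_trivial`).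
The integral homology of a compact manifold is finitely generated (`finite_singularHomology`), so
every action of `SL_n(ℚ)` on `M` is homologically trivial.

The action therefore stays homologically trivial when pulled back to `SL_n(ℤ)`, or further to
`SAut(F_n)`, and either form of the conjecture puts every transvection with entry `1` into the
kernel. Conjugating by diagonal matrices scales the entry by nonzero squares, and `p/q = pq ·
(1/q)²`, so a normal subgroup with these elements is everything (`eq_top_of_transvection_one_mem`).

The long part is finite generation. An open set may have infinitely generated homology, so the
inductive statement concerns images: if `closure A ⊆ W`, with `W` open, then the image of `H_n(A)`
in `H_n(W)` is finitely generated. Inside a chart, finitely many balls fit between `closure A` and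
`W`; a finite union of convex sets is handled by Mayer–Vietoris (`FGImage.union`), and so is the
passage from two open sets to their union (`LocallyFG.union`). Mayer–Vietoris rests on barycentric
subdivision (`exists_small_chains`), which is built on chains of tuples of points, where cones are
available, and then carried to singular chains by `realize`. -/

/-- Chains of tuples of `n` points of `X`: the augmented chain complex of the full simplex on `X`,
indexed by the number of vertices. -/
abbrev TupleChain (X : Type*) (n : ℕ) := (Fin n → X) →₀ ℤ

/-! ### Chains of tuples: cones, chain homotopies and subdivision -/

namespace TupleChain

variable {X Y : Type*}

/-- A tuple as a chain. -/
abbrev of {n : ℕ} (v : Fin n → X) : TupleChain X n := Finsupp.single v 1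

/-- The linear map that extends a function on tuples. -/
abbrev lift {A : Type*} [AddCommGroup A] {n : ℕ} (f : (Fin n → X) → A) : TupleChain X n →ₗ[ℤ] A :=
  Finsupp.linearCombination ℤ f

theorem lift_of {A : Type*} [AddCommGroup A] {n : ℕ} (f : (Fin n → X) → A) (v : Fin n → X) :
    lift f (of v) = f v := by simp

theorem hom_ext {A : Type*} [AddCommGroup A] {n : ℕ} {f g : TupleChain X n →ₗ[ℤ] A}
    (h : ∀ v, f (of v) = g (of v)) : f = g :=
  Finsupp.lhom_ext' fun v => LinearMap.ext_ring (h v)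

/-- The boundary map, the alternating sum of the faces. -/
def bd (n : ℕ) : TupleChain X (n + 1) →ₗ[ℤ] TupleChain X n :=
  lift fun v => ∑ i : Fin (n + 1), (-1 : ℤ) ^ (i : ℕ) • of (v ∘ i.succAbove)

theorem bd_of {n : ℕ} (v : Fin (n + 1) → X) :
    bd n (of v) = ∑ i : Fin (n + 1), (-1 : ℤ) ^ (i : ℕ) • of (v ∘ i.succAbove) :=
  lift_of _ _

/-- The cone over a chain with apex `b`. -/
def cone (b : X) (n : ℕ) : TupleChain X n →ₗ[ℤ] TupleChain X (n + 1) :=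
  lift fun v => of (Fin.cons b v : Fin (n + 1) → X)

theorem cone_of (b : X) {n : ℕ} (v : Fin n → X) :
    cone b n (of v) = of (Fin.cons b v : Fin (n + 1) → X) :=
  lift_of _ _

/-- The chain map induced by a function. -/
def map (f : X → Y) (n : ℕ) : TupleChain X n →ₗ[ℤ] TupleChain Y n :=
  lift fun v => of (f ∘ v)

theorem map_of (f : X → Y) {n : ℕ} (v : Fin n → X) : map f n (of v) = of (f ∘ v) :=
  lift_of _ _

theorem bd_map (f : X → Y) (n : ℕ) (x : TupleChain X (n + 1)) :
    bd n (map f (n + 1) x) = map f n (bd n x) := by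
  have : bd n ∘ₗ map f (n + 1) = map f n ∘ₗ bd n := hom_ext fun v => by
    simp only [LinearMap.comp_apply, map_of, bd_of, map_sum, map_smul]
    rfl
  exact LinearMap.congr_fun this x

theorem cone_map (f : X → Y) (b : X) (n : ℕ) (x : TupleChain X n) :
    cone (f b) n (map f n x) = map f (n + 1) (cone b n x) := by
  have : cone (f b) n ∘ₗ map f n = map f (n + 1) ∘ₗ cone b n := hom_ext fun v => by
    simp only [LinearMap.comp_apply, map_of, cone_of]
    congr 1
    exact (Fin.comp_cons f b v).symm
  exact LinearMap.congr_fun this x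

theorem bd_cone (b : X) (n : ℕ) (x : TupleChain X (n + 1)) :
    bd (n + 1) (cone b (n + 1) x) = x - cone b n (bd n x) := by
  have : bd (n + 1) ∘ₗ cone b (n + 1) = LinearMap.id - cone b n ∘ₗ bd n := hom_ext fun v => by
    simp only [LinearMap.comp_apply, LinearMap.sub_apply, LinearMap.id_apply, cone_of, bd_of,
      map_sum, map_smul]
    rw [Fin.sum_univ_succ, sub_eq_add_neg, ← Finset.sum_neg_distrib]
    congr 1
    · rw [Fin.val_zero, pow_zero, one_smul]
      rfl
    · refine Finset.sum_congr rfl fun i _ => ?_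
      have h : (Fin.cons b v : Fin (n + 2) → X) ∘ i.succ.succAbove =
          Fin.cons b (v ∘ i.succAbove) := by
        ext j
        refine Fin.cases ?_ (fun j => ?_) j <;> simp
      rw [h, Fin.val_succ, pow_succ, mul_neg_one, neg_smul]
  exact LinearMap.congr_fun this x

theorem bd_cone_zero (b : X) (x : TupleChain X 0) : bd 0 (cone b 0 x) = x := by
  have : bd 0 ∘ₗ cone b 0 = LinearMap.id := hom_ext fun v => by
    simp only [LinearMap.comp_apply, cone_of, bd_of, LinearMap.id_apply]
    rw [Fin.sum_univ_succ, Fin.sum_univ_zero, add_zero, Fin.val_zero, pow_zero, one_smul]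
    rfl
  exact LinearMap.congr_fun this x

theorem of_eq_cone {n : ℕ} (v : Fin (n + 1) → X) : of v = cone (v 0) n (of (Fin.tail v)) := by
  rw [cone_of, Fin.cons_self_tail]

/-- Every tuple is a cone over its tail, and the cone formula applied twice reduces the claim to one
degree lower. -/
theorem bd_bd (n : ℕ) (x : TupleChain X (n + 2)) : bd n (bd (n + 1) x) = 0 := by
  induction n with
  | zero =>
    have : bd 0 ∘ₗ bd 1 = (0 : TupleChain X 2 →ₗ[ℤ] TupleChain X 0) := hom_ext fun v => by
      rw [of_eq_cone, LinearMap.comp_apply, bd_cone, map_sub, bd_cone_zero, sub_self,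
        LinearMap.zero_apply]
    exact LinearMap.congr_fun this x
  | succ n ih =>
    have : bd (n + 1) ∘ₗ bd (n + 2) = (0 : TupleChain X (n + 3) →ₗ[ℤ] TupleChain X (n + 1)) :=
      hom_ext fun v => by
        rw [of_eq_cone, LinearMap.comp_apply, bd_cone, map_sub, bd_cone, ih, map_zero, sub_zero,
          sub_self, LinearMap.zero_apply]
    exact LinearMap.congr_fun this x

/-- The chain homotopy between two augmented chain maps which is built by taking cones with apex
`c v`. -/
def homotopy (φ ψ : ∀ n, TupleChain X n →ₗ[ℤ] TupleChain Y n) (c : X → Y) :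
    ∀ n, TupleChain X n →ₗ[ℤ] TupleChain Y (n + 1)
  | 0 => 0
  | n + 1 => lift fun v => cone (c (v 0)) (n + 1)
      (φ (n + 1) (of v) - ψ (n + 1) (of v) - homotopy φ ψ c n (bd n (of v)))

theorem homotopy_zero (φ ψ : ∀ n, TupleChain X n →ₗ[ℤ] TupleChain Y n) (c : X → Y) :
    homotopy φ ψ c 0 = 0 := rfl

theorem homotopy_of (φ ψ : ∀ n, TupleChain X n →ₗ[ℤ] TupleChain Y n) (c : X → Y) {n : ℕ}
    (v : Fin (n + 1) → X) :
    homotopy φ ψ c (n + 1) (of v) = cone (c (v 0)) (n + 1)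
      (φ (n + 1) (of v) - ψ (n + 1) (of v) - homotopy φ ψ c n (bd n (of v))) :=
  lift_of _ _

/-- By induction `φ - ψ - h ∂` takes values in cycles, and a cycle is the boundary of any cone over
it. The apex is thus irrelevant here; the choice `c (v 0)` matters only for naturality. The
condition `φ 0 = ψ 0` starts the induction at the empty tuple. -/
theorem bd_homotopy {φ ψ : ∀ n, TupleChain X n →ₗ[ℤ] TupleChain Y n} (c : X → Y)
    (hφ : ∀ n x, bd n (φ (n + 1) x) = φ n (bd n x))
    (hψ : ∀ n x, bd n (ψ (n + 1) x) = ψ n (bd n x)) (h0 : φ 0 = ψ 0) (n : ℕ)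
    (x : TupleChain X (n + 1)) :
    bd (n + 1) (homotopy φ ψ c (n + 1) x) =
      φ (n + 1) x - ψ (n + 1) x - homotopy φ ψ c n (bd n x) := by
  induction n with
  | zero =>
    have : bd 1 ∘ₗ homotopy φ ψ c 1 = φ 1 - ψ 1 - homotopy φ ψ c 0 ∘ₗ bd 0 := hom_ext fun v => by
      simp only [LinearMap.comp_apply, LinearMap.sub_apply, homotopy_of, bd_cone, map_sub, hφ, hψ,
        h0]
      simp [homotopy]
    exact LinearMap.congr_fun this x
  | succ n ih =>
    have : bd (n + 2) ∘ₗ homotopy φ ψ c (n + 2) =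
        φ (n + 2) - ψ (n + 2) - homotopy φ ψ c (n + 1) ∘ₗ bd (n + 1) := hom_ext fun v => by
      rw [LinearMap.comp_apply, homotopy_of, bd_cone, map_sub (bd (n + 1)), map_sub (bd (n + 1)),
        hφ, hψ, ih, bd_bd]
      simp
    exact LinearMap.congr_fun this x

theorem homotopy_map {X' Y' : Type*} {φ ψ : ∀ n, TupleChain X n →ₗ[ℤ] TupleChain Y n}
    {φ' ψ' : ∀ n, TupleChain X' n →ₗ[ℤ] TupleChain Y' n} {c : X → Y} {c' : X' → Y'}
    (f : X → X') (g : Y → Y')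
    (hφ : ∀ n x, φ' n (map f n x) = map g n (φ n x))
    (hψ : ∀ n x, ψ' n (map f n x) = map g n (ψ n x)) (hc : ∀ x, c' (f x) = g (c x)) (n : ℕ)
    (x : TupleChain X n) :
    homotopy φ' ψ' c' n (map f n x) = map g (n + 1) (homotopy φ ψ c n x) := by
  induction n with
  | zero => simp [homotopy]
  | succ n ih =>
    have : homotopy φ' ψ' c' (n + 1) ∘ₗ map f (n + 1) =
        map g (n + 2) ∘ₗ homotopy φ ψ c (n + 1) := hom_ext fun v => by
      rw [LinearMap.comp_apply, map_of, homotopy_of, ← map_of, hφ, hψ, bd_map, ih,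
        LinearMap.comp_apply, homotopy_of, ← cone_map, Function.comp_apply, hc]
      simp only [map_sub]
    exact LinearMap.congr_fun this x

/-- Barycentric subdivision with respect to a choice `β` of barycenters. -/
def subdivision (β : ∀ n, (Fin (n + 1) → X) → X) : ∀ n, TupleChain X n →ₗ[ℤ] TupleChain X n
  | 0 => LinearMap.id
  | n + 1 => lift fun v => cone (β n v) n (subdivision β n (bd n (of v)))

theorem subdivision_zero (β : ∀ n, (Fin (n + 1) → X) → X) :
    subdivision β 0 = LinearMap.id := rfl

theorem subdivision_of (β : ∀ n, (Fin (n + 1) → X) → X) {n : ℕ} (v : Fin (n + 1) → X) :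
    subdivision β (n + 1) (of v) = cone (β n v) n (subdivision β n (bd n (of v))) :=
  lift_of _ _

theorem bd_subdivision (β : ∀ n, (Fin (n + 1) → X) → X) (n : ℕ) (x : TupleChain X (n + 1)) :
    bd n (subdivision β (n + 1) x) = subdivision β n (bd n x) := by
  induction n with
  | zero =>
    have : bd 0 ∘ₗ subdivision β 1 = subdivision β 0 ∘ₗ bd 0 := hom_ext fun v => by
      rw [LinearMap.comp_apply, subdivision_of, bd_cone_zero, LinearMap.comp_apply]
    exact LinearMap.congr_fun this x
  | succ n ih =>
    have : bd (n + 1) ∘ₗ subdivision β (n + 2) = subdivision β (n + 1) ∘ₗ bd (n + 1) :=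
      hom_ext fun v => by
        rw [LinearMap.comp_apply, subdivision_of, bd_cone, ih, bd_bd, LinearMap.comp_apply]
        simp
    exact LinearMap.congr_fun this x

theorem subdivision_map {β : ∀ n, (Fin (n + 1) → X) → X} {β' : ∀ n, (Fin (n + 1) → Y) → Y}
    (f : X → Y) (hf : ∀ n v, β' n (f ∘ v) = f (β n v)) (n : ℕ) (x : TupleChain X n) :
    subdivision β' n (map f n x) = map f n (subdivision β n x) := by
  induction n with
  | zero => rfl
  | succ n ih =>
    have : subdivision β' (n + 1) ∘ₗ map f (n + 1) = map f (n + 1) ∘ₗ subdivision β (n + 1) :=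
      hom_ext fun v => by
        rw [LinearMap.comp_apply, map_of, subdivision_of, ← map_of, bd_map, ih, hf, cone_map,
          LinearMap.comp_apply, subdivision_of]
    exact LinearMap.congr_fun this x

/-- The span of the tuples in a set. -/
def spanOf {n : ℕ} (s : Set (Fin n → X)) : Submodule ℤ (TupleChain X n) :=
  Submodule.span ℤ (of '' s)

theorem of_mem_spanOf {n : ℕ} {s : Set (Fin n → X)} {v : Fin n → X} (h : v ∈ s) :
    of v ∈ spanOf s :=
  Submodule.subset_span ⟨v, h, rfl⟩

theorem spanOf_mono {n : ℕ} {s t : Set (Fin n → X)} (h : s ⊆ t) : spanOf s ≤ spanOf t :=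
  Submodule.span_mono (Set.image_mono h)

theorem map_mem_of_mem_spanOf {A : Type*} [AddCommGroup A] {n : ℕ} {s : Set (Fin n → X)}
    {f : TupleChain X n →ₗ[ℤ] A} {p : Submodule ℤ A} (h : ∀ v ∈ s, f (of v) ∈ p)
    {x : TupleChain X n} (hx : x ∈ spanOf s) : f x ∈ p := by
  have : spanOf s ≤ p.comap f := Submodule.span_le.2 <| by
    rintro _ ⟨v, hv, rfl⟩
    exact h v hv
  exact this hx

/-- If the barycenter `β v` of a tuple of diameter at most `d` has distance at most `r * d` from
the vertices and lies in every closed ball that contains the vertices, then the subdivision of a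
tuple of diameter at most `d` consists of tuples of diameter at most `r * d`. -/
theorem subdivision_of_mem_spanOf [PseudoMetricSpace X] {β : ∀ n, (Fin (n + 1) → X) → X} {N : ℕ}
    {r d : ℝ} (hr : 0 ≤ r * d)
    (h₁ : ∀ n, n ≤ N → ∀ v : Fin (n + 1) → X, (∀ i j, dist (v i) (v j) ≤ d) →
      ∀ i, dist (β n v) (v i) ≤ r * d)
    (h₂ : ∀ n, ∀ v : Fin (n + 1) → X, ∀ b ρ, (∀ i, dist b (v i) ≤ ρ) → dist b (β n v) ≤ ρ)
    (n : ℕ) (hn : n ≤ N + 1) (v : Fin n → X) (hv : ∀ i j, dist (v i) (v j) ≤ d) :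
    subdivision β n (of v) ∈ spanOf {w : Fin n → X | (∀ i j, dist (w i) (w j) ≤ r * d) ∧
      ∀ b ρ, (∀ i, dist b (v i) ≤ ρ) → ∀ i, dist b (w i) ≤ ρ} := by
  induction n with
  | zero => exact of_mem_spanOf ⟨fun i => i.elim0, fun _ _ _ i => i.elim0⟩
  | succ n ih =>
    rw [subdivision_of, bd_of, map_sum, map_sum]
    refine Submodule.sum_mem _ fun i _ => ?_
    rw [map_smul, map_smul]
    refine Submodule.smul_mem _ _ ?_
    refine map_mem_of_mem_spanOf ?_ (ih (by omega) (v ∘ i.succAbove) fun j k => hv _ _)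
    rintro w ⟨hw, hw'⟩
    rw [cone_of]
    refine of_mem_spanOf ⟨?_, fun b ρ hb => ?_⟩
    -- This is what the ball condition in the induction claim is for: a ball about the new
    -- barycenter that contains the vertices of the face also contains the vertices of its
    -- subdivision.
    · have h : ∀ j, dist (β n v) (w j) ≤ r * d :=
        hw' _ _ fun j => h₁ n (by omega) v hv _
      refine Fin.cases (Fin.cases ?_ fun k => ?_) fun j => Fin.cases ?_ fun k => ?_
      · simpa using hr
      · simpa using h k
      · simpa [dist_comm] using h j
      · simpa using hw j k
    · refine Fin.cases ?_ fun j => ?_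
      · simpa using h₂ n v b ρ hb
      · simpa using hw' b ρ (fun _ => hb _) j

/-- The chain homotopy from the identity to the barycentric subdivision. -/
def subdivisionHomotopy (β : ∀ n, (Fin (n + 1) → X) → X) (n : ℕ) :
    TupleChain X n →ₗ[ℤ] TupleChain X (n + 1) :=
  homotopy (fun _ => LinearMap.id) (subdivision β) id n

theorem subdivisionHomotopy_zero (β : ∀ n, (Fin (n + 1) → X) → X) :
    subdivisionHomotopy β 0 = 0 := rfl

theorem bd_subdivisionHomotopy (β : ∀ n, (Fin (n + 1) → X) → X) (n : ℕ)
    (x : TupleChain X (n + 1)) :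
    bd (n + 1) (subdivisionHomotopy β (n + 1) x) =
      x - subdivision β (n + 1) x - subdivisionHomotopy β n (bd n x) :=
  bd_homotopy id (fun _ _ => rfl) (bd_subdivision β) (subdivision_zero β).symm n x

theorem subdivisionHomotopy_map {β : ∀ n, (Fin (n + 1) → X) → X}
    {β' : ∀ n, (Fin (n + 1) → Y) → Y} (f : X → Y) (hf : ∀ n v, β' n (f ∘ v) = f (β n v)) (n : ℕ)
    (x : TupleChain X n) :
    subdivisionHomotopy β' n (map f n x) = map f (n + 1) (subdivisionHomotopy β n x) :=
  homotopy_map f f (fun _ _ => rfl) (subdivision_map f hf) (fun _ => rfl) n x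

end TupleChain

/-! ### Affine simplices in convex sets and the barycenter estimate -/

/-- The standard topological `n`-simplex. -/
abbrev TopSimplex (n : ℕ) := stdSimplex ℝ (Fin (n + 1))

namespace TopSimplex

/-- The inclusion of the `i`-th face. -/
def face {n : ℕ} (i : Fin (n + 2)) : C(TopSimplex n, TopSimplex (n + 1)) :=
  ⟨stdSimplex.map i.succAbove, stdSimplex.continuous_map _⟩

/-- The vertices of the standard simplex. -/
def vertices (n : ℕ) : Fin (n + 1) → TopSimplex n := fun i => stdSimplex.vertex i

theorem convex (n : ℕ) : Convex ℝ (stdSimplex ℝ (Fin (n + 1))) := convex_stdSimplex ℝ _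

variable {E : Type*} [NormedAddCommGroup E] [NormedSpace ℝ E] {K : Set E} (hK : Convex ℝ K)
  {F : Type*} [NormedAddCommGroup F] [NormedSpace ℝ F] {L : Set F} (hL : Convex ℝ L)

/-- The affine map from the standard simplex to a convex set with given values at the vertices. -/
def comb {n : ℕ} (v : Fin (n + 1) → K) : C(TopSimplex n, K) where
  toFun t := ⟨∑ j, t j • (v j : E),
    hK.sum_mem (fun j _ => t.2.1 j) t.2.2 fun j _ => (v j).2⟩
  continuous_toFun := by
    refine Continuous.subtype_mk (continuous_finsetSum _ fun j _ => ?_) _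
    exact ((continuous_apply j).comp continuous_subtype_val).smul continuous_const

theorem coe_comb {n : ℕ} (v : Fin (n + 1) → K) (t : TopSimplex n) :
    (comb hK v t : E) = ∑ j, t j • (v j : E) := rfl

theorem comb_face {n : ℕ} (v : Fin (n + 2) → K) (i : Fin (n + 2)) :
    (comb hK v).comp (face i) = comb hK (v ∘ i.succAbove) := by
  ext t
  have h : ∀ j, (face i t) j = ∑ k with i.succAbove k = j, t k := fun j => by
    change FunOnFinite.linearMap ℝ ℝ i.succAbove t j = _
    rw [FunOnFinite.linearMap_apply_apply]
  simp only [ContinuousMap.comp_apply, coe_comb, h, Finset.sum_smul]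
  rw [← Finset.sum_fiberwise Finset.univ i.succAbove]
  refine Finset.sum_congr rfl fun j _ => Finset.sum_congr rfl fun k hk => ?_
  simp only [Finset.mem_filter] at hk
  simp [hk.2]

theorem comb_apply {n m : ℕ} (v : Fin (n + 1) → TopSimplex m) (t : TopSimplex n)
    (i : Fin (m + 1)) : (comb (convex_stdSimplex ℝ _) v t) i = ∑ j, t j * v j i := by
  change (comb (convex_stdSimplex ℝ _) v t).1 i = _
  rw [coe_comb, Finset.sum_apply]
  rfl

theorem comb_vertex {n : ℕ} (v : Fin (n + 1) → K) (i : Fin (n + 1)) :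
    comb hK v (vertices n i) = v i := by
  ext
  rw [coe_comb, Finset.sum_eq_single i]
  · simp [vertices]
  · intro j _ hj
    simp [vertices, hj]
  · simp

theorem comb_vertices (n : ℕ) : comb (convex n) (vertices n) = ContinuousMap.id _ := by
  ext t i
  rw [ContinuousMap.id_apply, comb_apply]
  simp [vertices, Pi.single_apply]

theorem face_eq_comb {n : ℕ} (i : Fin (n + 2)) :
    face i = comb (convex (n + 1)) (vertices (n + 1) ∘ i.succAbove) := by
  rw [← comb_face, comb_vertices, ContinuousMap.id_comp]

/-- A continuous map between convex sets that commutes with convex combinations. -/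
def IsAffine (g : C(K, L)) : Prop :=
  ∀ (n : ℕ) (v : Fin (n + 1) → K), g.comp (comb hK v) = comb hL (g ∘ v)

theorem isAffine_comb {n : ℕ} (v : Fin (n + 1) → K) : IsAffine (convex n) hK (comb hK v) := by
  intro m w
  ext t
  simp only [ContinuousMap.comp_apply, coe_comb, Function.comp_apply, Finset.smul_sum]
  rw [Finset.sum_comm]
  refine Finset.sum_congr rfl fun j _ => ?_
  rw [comb_apply, Finset.sum_smul]
  simp only [mul_smul]

theorem isAffine_face {n : ℕ} (i : Fin (n + 2)) :
    IsAffine (convex n) (convex (n + 1)) (face i) := by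
  rw [face_eq_comb]
  exact isAffine_comb _ _

/-- The barycenter of a tuple. -/
def bary (n : ℕ) (v : Fin (n + 1) → K) : K := comb hK v stdSimplex.barycenter

variable {hK hL} in
theorem IsAffine.map_bary {g : C(K, L)} (hg : IsAffine hK hL g) (n : ℕ) (v : Fin (n + 1) → K) :
    bary hL n (g ∘ v) = g (bary hK n v) := by
  rw [bary, ← hg n v]
  rfl

theorem dist_comb_le {n : ℕ} (v : Fin (n + 1) → K) (t : TopSimplex n) (b : K) (ρ : ℝ)
    (h : ∀ i, dist b (v i) ≤ ρ) : dist b (comb hK v t) ≤ ρ := by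
  have : (comb hK v t : E) ∈ Metric.closedBall (b : E) ρ :=
    (convex_closedBall _ _).sum_mem (fun j _ => t.2.1 j) t.2.2 fun j _ => by
      rw [Metric.mem_closedBall, dist_comm]
      exact h j
  rw [dist_comm]
  exact this

/-- The vector from `v i` to the barycenter is the average of `n + 1` differences, one of which is
zero, so its length is at most `n / (n + 1) * d`. Replacing `n` by `N` gives one contraction factor
for all faces of an `N`-simplex. -/
theorem dist_bary_le {n N : ℕ} (hn : n ≤ N) (v : Fin (n + 1) → K) {d : ℝ}
    (hv : ∀ i j, dist (v i) (v j) ≤ d) (i : Fin (n + 1)) :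
    dist (bary hK n v) (v i) ≤ (N / (N + 1) : ℝ) * d := by
  have hd : 0 ≤ d := by simpa using hv i i
  have hb : (stdSimplex.barycenter : TopSimplex n) = fun _ : Fin (n + 1) => ((n : ℝ) + 1)⁻¹ := by
    ext j
    change (Fintype.card (Fin (n + 1)) : ℝ)⁻¹ = _
    simp
  have hn0 : (0 : ℝ) < n + 1 := by positivity
  have h1 : ((bary hK n v : E) - v i) = ∑ j, ((n : ℝ) + 1)⁻¹ • ((v j : E) - v i) := by
    rw [bary, coe_comb]
    simp only [smul_sub, Finset.sum_sub_distrib]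
    congr 1
    · simp only [hb]
    · rw [Finset.sum_const, Finset.card_univ, Fintype.card_fin, ← Nat.cast_smul_eq_nsmul ℝ,
        smul_smul]
      push_cast
      rw [mul_inv_cancel₀ hn0.ne', one_smul]
  rw [Subtype.dist_eq, dist_eq_norm, h1]
  calc ‖∑ j, ((n : ℝ) + 1)⁻¹ • ((v j : E) - v i)‖
      ≤ ∑ j, ((n : ℝ) + 1)⁻¹ * dist (v j) (v i) := by
        refine (norm_sum_le _ _).trans (Finset.sum_le_sum fun j _ => ?_)
        rw [norm_smul, Real.norm_of_nonneg (by positivity), Subtype.dist_eq, dist_eq_norm]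
    _ = ∑ j ∈ Finset.univ.erase i, ((n : ℝ) + 1)⁻¹ * dist (v j) (v i) := by
        rw [← Finset.sum_erase_add _ _ (Finset.mem_univ i)]
        simp
    _ ≤ ∑ j ∈ Finset.univ.erase i, ((n : ℝ) + 1)⁻¹ * d :=
        Finset.sum_le_sum fun j _ => by gcongr; exact hv j i
    _ = (n / (n + 1) : ℝ) * d := by
        rw [Finset.sum_const, Finset.card_erase_of_mem (Finset.mem_univ i), Finset.card_univ,
          Fintype.card_fin, Nat.add_sub_cancel, nsmul_eq_mul]
        ring
    _ ≤ (N / (N + 1) : ℝ) * d := by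
        refine mul_le_mul_of_nonneg_right ?_ hd
        rw [div_le_div_iff₀ hn0 (by positivity)]
        have : (n : ℝ) ≤ N := by exact_mod_cast hn
        nlinarith

end TopSimplex

open TopSimplex

/-! ### Singular chains, barycentric subdivision and small chains -/

/-- Singular chains. -/
abbrev SingularChain (M : Type*) [TopologicalSpace M] (n : ℕ) := C(TopSimplex n, M) →₀ ℤ

namespace SingularChain

variable {M : Type*} [TopologicalSpace M] {N : Type*} [TopologicalSpace N]

/-- A singular simplex as a chain. -/
abbrev of {n : ℕ} (σ : C(TopSimplex n, M)) : SingularChain M n := Finsupp.single σ 1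

theorem hom_ext {A : Type*} [AddCommGroup A] [Module ℤ A] {n : ℕ} {f g : SingularChain M n →ₗ[ℤ] A}
    (h : ∀ σ, f (of σ) = g (of σ)) : f = g :=
  Finsupp.lhom_ext' fun v => LinearMap.ext_ring (h v)

/-- The linear map that extends a function on singular simplices. -/
abbrev lift {A : Type*} [AddCommGroup A] [Module ℤ A] {n : ℕ} (f : C(TopSimplex n, M) → A) :
    SingularChain M n →ₗ[ℤ] A :=
  Finsupp.linearCombination ℤ f

theorem lift_of {A : Type*} [AddCommGroup A] [Module ℤ A] {n : ℕ} (f : C(TopSimplex n, M) → A)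
    (σ : C(TopSimplex n, M)) : lift f (of σ) = f σ := by
  rw [Finsupp.linearCombination_single]
  exact @one_smul ℤ A _ Module.toDistribMulAction.toMulAction (f σ)

/-- The singular boundary map. -/
def bd (n : ℕ) : SingularChain M (n + 1) →ₗ[ℤ] SingularChain M n :=
  lift fun σ => ∑ i : Fin (n + 2), (-1 : ℤ) ^ (i : ℕ) • of (σ.comp (face i))

theorem bd_of {n : ℕ} (σ : C(TopSimplex (n + 1), M)) :
    bd n (of σ) = ∑ i : Fin (n + 2), (-1 : ℤ) ^ (i : ℕ) • of (σ.comp (face i)) :=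
  lift_of _ _

/-- The chain map induced by a continuous map. -/
def map (f : C(M, N)) (n : ℕ) : SingularChain M n →ₗ[ℤ] SingularChain N n :=
  lift fun σ => of (f.comp σ)

theorem map_of (f : C(M, N)) {n : ℕ} (σ : C(TopSimplex n, M)) : map f n (of σ) = of (f.comp σ) :=
  lift_of _ _

theorem bd_map (f : C(M, N)) (n : ℕ) (x : SingularChain M (n + 1)) :
    bd n (map f (n + 1) x) = map f n (bd n x) := by
  have : bd n ∘ₗ map f (n + 1) = map f n ∘ₗ bd n := hom_ext fun v => by
    simp only [LinearMap.comp_apply, map_of, bd_of, map_sum, map_smul]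
    rfl
  exact LinearMap.congr_fun this x

section realize

variable {E : Type*} [NormedAddCommGroup E] [NormedSpace ℝ E] {K : Set E} (hK : Convex ℝ K)
  {F : Type*} [NormedAddCommGroup F] [NormedSpace ℝ F] {L : Set F} (hL : Convex ℝ L)

/-- The singular chain in `M` that a continuous map from a convex set makes of a chain of
tuples. -/
def realize (f : C(K, M)) (n : ℕ) : TupleChain K (n + 1) →ₗ[ℤ] SingularChain M n :=
  TupleChain.lift fun v => of (f.comp (comb hK v))

theorem realize_of (f : C(K, M)) {n : ℕ} (v : Fin (n + 1) → K) :
    realize hK f n (TupleChain.of v) = of (f.comp (comb hK v)) :=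
  TupleChain.lift_of _ _

theorem bd_realize (f : C(K, M)) (n : ℕ) (x : TupleChain K (n + 2)) :
    bd n (realize hK f (n + 1) x) = realize hK f n (TupleChain.bd (n + 1) x) := by
  have : bd n ∘ₗ realize hK f (n + 1) = realize hK f n ∘ₗ TupleChain.bd (n + 1) :=
    TupleChain.hom_ext fun v => by
      simp only [LinearMap.comp_apply, realize_of, bd_of, TupleChain.bd_of, map_sum, map_smul,
        ContinuousMap.comp_assoc, comb_face]
  exact LinearMap.congr_fun this x

-- Naturality under affine maps. Operators on singular chains are defined on the universal tuple
-- `vertices n`; this identity lets them be compared on faces and on arbitrary affine simplices.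
variable {hK hL} in
theorem realize_map {g : C(K, L)} (hg : IsAffine hK hL g) (f : C(L, M)) (n : ℕ)
    (x : TupleChain K (n + 1)) :
    realize hL f n (TupleChain.map g (n + 1) x) = realize hK (f.comp g) n x := by
  have : realize hL f n ∘ₗ TupleChain.map g (n + 1) = realize hK (f.comp g) n :=
    TupleChain.hom_ext fun v => by
      rw [LinearMap.comp_apply, TupleChain.map_of, realize_of, realize_of, ← hg n v,
        ContinuousMap.comp_assoc]
  exact LinearMap.congr_fun this x

theorem realize_vertices {n : ℕ} (σ : C(TopSimplex n, M)) :
    realize (convex n) σ n (TupleChain.of (vertices n)) = of σ := by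
  rw [realize_of, comb_vertices, ContinuousMap.comp_id]

end realize

/-- The faces of the universal simplex are images of the universal simplex one dimension lower. With
naturality, this turns identities between tuple chains into identities between singular operators.
-/
theorem bd_vertices (n : ℕ) : TupleChain.bd (n + 1) (TupleChain.of (vertices (n + 1))) =
    ∑ i : Fin (n + 2), (-1 : ℤ) ^ (i : ℕ) •
      TupleChain.map (face i) (n + 1) (TupleChain.of (vertices n)) := by
  rw [TupleChain.bd_of]
  refine Finset.sum_congr rfl fun i _ => ?_
  rw [TupleChain.map_of]
  congr 2
  ext1 j
  exact (stdSimplex.map_vertex (S := ℝ) i.succAbove j).symm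

theorem bd_bd (n : ℕ) (x : SingularChain M (n + 2)) : bd n (bd (n + 1) x) = 0 := by
  have : bd n ∘ₗ bd (n + 1) = (0 : SingularChain M (n + 2) →ₗ[ℤ] SingularChain M n) :=
    hom_ext fun σ => by
      rw [LinearMap.comp_apply, ← realize_vertices, bd_realize, bd_realize, TupleChain.bd_bd,
        map_zero, LinearMap.zero_apply]
  exact LinearMap.congr_fun this x

/-- The chains whose simplices lie in a given set. -/
def chainsIn (U : Set M) (n : ℕ) : Submodule ℤ (SingularChain M n) :=
  Finsupp.supported ℤ ℤ {σ : C(TopSimplex n, M) | Set.range σ ⊆ U}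

theorem of_mem_chainsIn {U : Set M} {n : ℕ} {σ : C(TopSimplex n, M)} (h : Set.range σ ⊆ U) :
    of σ ∈ chainsIn U n :=
  Finsupp.single_mem_supported ℤ 1 h

theorem map_mem_of_mem_chainsIn {A : Type*} [AddCommGroup A] {U : Set M} {n : ℕ}
    {f : SingularChain M n →ₗ[ℤ] A} {p : Submodule ℤ A}
    (h : ∀ σ : C(TopSimplex n, M), Set.range σ ⊆ U → f (of σ) ∈ p)
    {x : SingularChain M n} (hx : x ∈ chainsIn U n) : f x ∈ p := by
  have : chainsIn U n ≤ p.comap f := by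
    rw [chainsIn, Finsupp.supported_eq_span_single, Submodule.span_le]
    rintro _ ⟨σ, hσ, rfl⟩
    exact h σ hσ
  exact this hx

theorem chainsIn_mono {U V : Set M} (h : U ⊆ V) (n : ℕ) : chainsIn U n ≤ chainsIn V n :=
  Finsupp.supported_mono fun _ hσ => hσ.trans h

theorem chainsIn_univ (n : ℕ) : chainsIn (Set.univ : Set M) n = ⊤ := by
  simp [chainsIn]

theorem mem_chainsIn_inter {U V : Set M} {n : ℕ} {x : SingularChain M n} (hU : x ∈ chainsIn U n)
    (hV : x ∈ chainsIn V n) : x ∈ chainsIn (U ∩ V) n := by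
  have h : chainsIn (U ∩ V) n = chainsIn U n ⊓ chainsIn V n := by
    rw [chainsIn, chainsIn, chainsIn, ← Finsupp.supported_inter]
    congr 1
    ext σ
    exact Set.subset_inter_iff
  rw [h]
  exact ⟨hU, hV⟩

theorem bd_mem_chainsIn {U : Set M} {n : ℕ} {x : SingularChain M (n + 1)}
    (hx : x ∈ chainsIn U (n + 1)) : bd n x ∈ chainsIn U n := by
  refine map_mem_of_mem_chainsIn (fun σ hσ => ?_) hx
  rw [bd_of]
  refine Submodule.sum_mem _ fun i _ => Submodule.smul_mem _ _ (of_mem_chainsIn ?_)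
  exact (Set.range_comp_subset_range (face i) σ).trans hσ

theorem realize_mem_chainsIn {E : Type*} [NormedAddCommGroup E] [NormedSpace ℝ E] {K : Set E}
    (hK : Convex ℝ K) {U : Set M} {f : C(K, M)} (hf : Set.range f ⊆ U) (n : ℕ)
    (x : TupleChain K (n + 1)) : realize hK f n x ∈ chainsIn U n := by
  have : LinearMap.range (realize hK f n) ≤ chainsIn U n := by
    rw [realize, Finsupp.range_linearCombination, Submodule.span_le]
    rintro _ ⟨v, rfl⟩
    exact of_mem_chainsIn ((Set.range_comp_subset_range (comb hK v) f).trans hf)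
  exact this ⟨x, rfl⟩

theorem map_mem_chainsIn {U : Set N} {f : C(M, N)} (hf : Set.range f ⊆ U) (n : ℕ)
    (x : SingularChain M n) : map f n x ∈ chainsIn U n := by
  have : LinearMap.range (map f n) ≤ chainsIn U n := by
    rw [map, Finsupp.range_linearCombination, Submodule.span_le]
    rintro _ ⟨v, rfl⟩
    exact of_mem_chainsIn ((Set.range_comp_subset_range v f).trans hf)
  exact this ⟨x, rfl⟩

/-- Singular cycles; in degree `0`, all chains. -/
def cycles (M : Type*) [TopologicalSpace M] : ∀ n, Submodule ℤ (SingularChain M n)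
  | 0 => ⊤
  | n + 1 => LinearMap.ker (bd n)

theorem bd_mem_cycles {n : ℕ} (x : SingularChain M (n + 1)) : bd n x ∈ cycles M n := by
  cases n with
  | zero => exact Submodule.mem_top
  | succ n => exact bd_bd n x

/-- The boundaries of the chains in a given set. -/
def boundariesIn (U : Set M) (n : ℕ) : Submodule ℤ (SingularChain M n) :=
  (chainsIn U (n + 1)).map (bd n)

theorem boundariesIn_mono {U V : Set M} (h : U ⊆ V) (n : ℕ) :
    boundariesIn U n ≤ boundariesIn V n :=
  Submodule.map_mono (chainsIn_mono h _)

theorem boundariesIn_le_cycles (U : Set M) (n : ℕ) : boundariesIn U n ≤ cycles M n := by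
  rintro _ ⟨x, _, rfl⟩
  exact bd_mem_cycles x

/-- The barycenter of a tuple of points of the standard simplex. -/
def simplexBary (n : ℕ) : ∀ m, (Fin (m + 1) → TopSimplex n) → TopSimplex n := bary (convex n)

theorem simplexBary_map {n m : ℕ} {f : C(TopSimplex n, TopSimplex m)}
    (hf : IsAffine (convex n) (convex m) f) (k : ℕ) (v : Fin (k + 1) → TopSimplex n) :
    simplexBary m k (f ∘ v) = f (simplexBary n k v) :=
  hf.map_bary k v

/-- Barycentric subdivision of singular chains. -/
def subdivision (n : ℕ) : SingularChain M n →ₗ[ℤ] SingularChain M n :=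
  lift fun σ => realize (convex n) σ n
    (TupleChain.subdivision (simplexBary n) (n + 1) (TupleChain.of (vertices n)))

theorem subdivision_of {n : ℕ} (σ : C(TopSimplex n, M)) :
    subdivision n (of σ) = realize (convex n) σ n
      (TupleChain.subdivision (simplexBary n) (n + 1) (TupleChain.of (vertices n))) :=
  lift_of _ _

/-- The chain homotopy from the identity to the barycentric subdivision. -/
def subdivisionHomotopy (n : ℕ) : SingularChain M n →ₗ[ℤ] SingularChain M (n + 1) :=
  lift fun σ => realize (convex n) σ (n + 1)
    (TupleChain.subdivisionHomotopy (simplexBary n) (n + 1) (TupleChain.of (vertices n)))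

theorem subdivisionHomotopy_of {n : ℕ} (σ : C(TopSimplex n, M)) :
    subdivisionHomotopy n (of σ) = realize (convex n) σ (n + 1)
      (TupleChain.subdivisionHomotopy (simplexBary n) (n + 1) (TupleChain.of (vertices n))) :=
  lift_of _ _

/-- No correction term appears in degree `0`, since the homotopy of tuple chains vanishes on the
empty tuple. -/
theorem bd_subdivisionHomotopy_zero (x : SingularChain M 0) :
    bd 0 (subdivisionHomotopy 0 x) = x - subdivision 0 x := by
  have : bd 0 ∘ₗ subdivisionHomotopy 0 =
      (LinearMap.id - subdivision 0 : SingularChain M 0 →ₗ[ℤ] SingularChain M 0) :=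
    hom_ext fun σ => by
      rw [LinearMap.comp_apply, subdivisionHomotopy_of, bd_realize,
        TupleChain.bd_subdivisionHomotopy, map_sub,
        map_sub, realize_vertices, LinearMap.sub_apply, subdivision_of,
        TupleChain.subdivisionHomotopy_zero]
      simp
  exact LinearMap.congr_fun this x

theorem bd_subdivisionHomotopy (n : ℕ) (x : SingularChain M (n + 1)) :
    bd (n + 1) (subdivisionHomotopy (n + 1) x) =
      x - subdivision (n + 1) x - subdivisionHomotopy n (bd n x) := by
  have : bd (n + 1) ∘ₗ subdivisionHomotopy (n + 1) = (LinearMap.id - subdivision (n + 1) -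
      subdivisionHomotopy n ∘ₗ bd n : SingularChain M (n + 1) →ₗ[ℤ] SingularChain M (n + 1)) :=
    hom_ext fun σ => by
      have key : realize (convex (n + 1)) σ (n + 1)
          (TupleChain.subdivisionHomotopy (simplexBary (n + 1)) (n + 1)
          (TupleChain.bd (n + 1) (TupleChain.of (vertices (n + 1))))) =
          subdivisionHomotopy n (bd n (of σ)) := by
        rw [bd_vertices, bd_of]
        simp only [map_sum, map_smul]
        refine Finset.sum_congr rfl fun i _ => ?_
        congr 1
        rw [subdivisionHomotopy_of, ← realize_map (isAffine_face i)]
        congr 1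
        exact TupleChain.subdivisionHomotopy_map _ (simplexBary_map (isAffine_face i)) _ _
      rw [LinearMap.comp_apply, subdivisionHomotopy_of, bd_realize,
        TupleChain.bd_subdivisionHomotopy, map_sub,
        map_sub, realize_vertices, LinearMap.sub_apply, LinearMap.sub_apply, subdivision_of,
        LinearMap.comp_apply, key, LinearMap.id_apply]
  exact LinearMap.congr_fun this x

theorem subdivision_mem_chainsIn {U : Set M} {n : ℕ} {x : SingularChain M n}
    (hx : x ∈ chainsIn U n) : subdivision n x ∈ chainsIn U n := by
  refine map_mem_of_mem_chainsIn (fun σ hσ => ?_) hx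
  rw [subdivision_of]
  exact realize_mem_chainsIn _ hσ _ _

theorem subdivisionHomotopy_mem_chainsIn {U : Set M} {n : ℕ} {x : SingularChain M n}
    (hx : x ∈ chainsIn U n) : subdivisionHomotopy n x ∈ chainsIn U (n + 1) := by
  refine map_mem_of_mem_chainsIn (fun σ hσ => ?_) hx
  rw [subdivisionHomotopy_of]
  exact realize_mem_chainsIn _ hσ _ _

theorem sub_subdivision_mem_boundariesIn {U : Set M} {n : ℕ} {x : SingularChain M n}
    (hx : x ∈ chainsIn U n) (hc : x ∈ cycles M n) : x - subdivision n x ∈ boundariesIn U n := by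
  refine ⟨subdivisionHomotopy n x, subdivisionHomotopy_mem_chainsIn hx, ?_⟩
  cases n with
  | zero => exact bd_subdivisionHomotopy_zero x
  | succ n =>
    have h : bd n x = 0 := hc
    rw [bd_subdivisionHomotopy, h, map_zero, sub_zero]

theorem subdivision_mem_cycles {n : ℕ} {x : SingularChain M n} (hc : x ∈ cycles M n) :
    subdivision n x ∈ cycles M n := by
  have h := boundariesIn_le_cycles Set.univ n
    (sub_subdivision_mem_boundariesIn (by rw [chainsIn_univ]; trivial) hc)
  simpa using Submodule.sub_mem _ hc h

theorem sub_iterate_subdivision_mem_boundariesIn {U : Set M} {n : ℕ} (m : ℕ)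
    {x : SingularChain M n} (hx : x ∈ chainsIn U n) (hc : x ∈ cycles M n) :
    x - (subdivision n)^[m] x ∈ boundariesIn U n := by
  induction m generalizing x with
  | zero => simp
  | succ m ih =>
    rw [Function.iterate_succ_apply]
    have h := ih (subdivision_mem_chainsIn hx) (subdivision_mem_cycles hc)
    simpa using Submodule.add_mem _ (sub_subdivision_mem_boundariesIn hx hc) h

/-- An affine simplex respects barycenters, so subdividing it as a singular simplex is the same as
subdividing its tuple of vertices. Iterated subdivisions can thus be measured inside the standard
simplex. -/
theorem realize_subdivision {n m : ℕ} (σ : C(TopSimplex n, M))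
    (x : TupleChain (TopSimplex n) (m + 1)) :
    realize (convex n) σ m (TupleChain.subdivision (simplexBary n) (m + 1) x) =
      subdivision m (realize (convex n) σ m x) := by
  have : realize (convex n) σ m ∘ₗ TupleChain.subdivision (simplexBary n) (m + 1) =
      subdivision m ∘ₗ realize (convex n) σ m := TupleChain.hom_ext fun w => by
    have h : comb (convex n) w ∘ vertices m = w := funext fun i => comb_vertex _ _ _
    rw [LinearMap.comp_apply, LinearMap.comp_apply, realize_of, subdivision_of,
      ← realize_map (isAffine_comb (convex n) w), ← TupleChain.subdivision_map
        (comb (convex n) w) (simplexBary_map (isAffine_comb (convex n) w)), TupleChain.map_of, h]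
  exact LinearMap.congr_fun this x

theorem iterate_subdivision_of {n : ℕ} (σ : C(TopSimplex n, M)) (m : ℕ) :
    (subdivision n)^[m] (of σ) = realize (convex n) σ n
      ((TupleChain.subdivision (simplexBary n) (n + 1))^[m] (TupleChain.of (vertices n))) := by
  induction m with
  | zero => exact (realize_vertices σ).symm
  | succ m ih => rw [Function.iterate_succ_apply', Function.iterate_succ_apply', ih,
      realize_subdivision]

/-- The tuples of diameter at most `d`. -/
def smallTuples (n k : ℕ) (d : ℝ) : Set (Fin k → TopSimplex n) :=
  {w | ∀ i j, dist (w i) (w j) ≤ d}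

theorem subdivision_mem_spanOf_smallTuples {n : ℕ} {d : ℝ} (hd : 0 ≤ d)
    {x : TupleChain (TopSimplex n) (n + 1)}
    (hx : x ∈ TupleChain.spanOf (smallTuples n (n + 1) d)) :
    TupleChain.subdivision (simplexBary n) (n + 1) x ∈
      TupleChain.spanOf (smallTuples n (n + 1) ((n / (n + 1) : ℝ) * d)) := by
  refine TupleChain.map_mem_of_mem_spanOf (fun v hv => ?_) hx
  refine TupleChain.spanOf_mono (fun w hw => hw.1) (TupleChain.subdivision_of_mem_spanOf (N := n)
    (by positivity) ?_ ?_ (n + 1) le_rfl v hv)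
  · exact fun k hk w hw i => dist_bary_le (convex n) hk w hw i
  · exact fun k w b ρ h => dist_comb_le (convex n) w _ b ρ h

theorem iterate_subdivision_mem_spanOf_smallTuples (n : ℕ) : ∃ d : ℝ, 0 ≤ d ∧ ∀ m : ℕ,
    (TupleChain.subdivision (simplexBary n) (n + 1))^[m] (TupleChain.of (vertices n)) ∈
      TupleChain.spanOf (smallTuples n (n + 1) ((n / (n + 1) : ℝ) ^ m * d)) := by
  refine ⟨Metric.diam (Set.univ : Set (TopSimplex n)), Metric.diam_nonneg, fun m => ?_⟩
  induction m with
  | zero =>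
    refine TupleChain.of_mem_spanOf fun i j => ?_
    rw [pow_zero, one_mul]
    exact Metric.dist_le_diam_of_mem isCompact_univ.isBounded trivial trivial
  | succ m ih =>
    rw [Function.iterate_succ_apply', pow_succ', mul_assoc]
    exact subdivision_mem_spanOf_smallTuples
      (mul_nonneg (by positivity) Metric.diam_nonneg) ih

/-- The Lebesgue number of the cover of the standard simplex by the preimages of `U` and `V`
eventually exceeds the mesh, which shrinks by the factor `n / (n + 1)` at each subdivision. -/
theorem exists_iterate_subdivision_of_mem {U V : Set M} (hU : IsOpen U) (hV : IsOpen V) {n : ℕ}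
    {σ : C(TopSimplex n, M)} (hσ : Set.range σ ⊆ U ∪ V) :
    ∃ m, (subdivision n)^[m] (of σ) ∈ chainsIn U n ⊔ chainsIn V n := by
  obtain ⟨δ, hδ, hball⟩ := lebesgue_number_lemma_of_metric
    (c := fun b : Bool => σ ⁻¹' (if b then U else V)) (isCompact_univ (X := TopSimplex n))
    (fun b => (by cases b <;> simpa : IsOpen (if b then U else V)).preimage σ.continuous)
    (fun t _ => by
      rcases hσ ⟨t, rfl⟩ with h | h
      · exact Set.mem_iUnion.2 ⟨true, by simpa using h⟩
      · exact Set.mem_iUnion.2 ⟨false, by simpa using h⟩)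
  obtain ⟨d, hd, hm⟩ := iterate_subdivision_mem_spanOf_smallTuples n
  have hr : (n / (n + 1) : ℝ) < 1 := by
    rw [div_lt_one (by positivity)]
    linarith
  obtain ⟨m, hm'⟩ : ∃ m : ℕ, (n / (n + 1) : ℝ) ^ m * d < δ := by
    have h := (tendsto_pow_atTop_nhds_zero_of_lt_one (by positivity) hr).mul_const d
    rw [zero_mul] at h
    exact (h.eventually_lt_const hδ).exists
  refine ⟨m, ?_⟩
  rw [iterate_subdivision_of]
  refine TupleChain.map_mem_of_mem_spanOf (fun w hw => ?_) (hm m)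
  rw [realize_of]
  -- The ball about the first vertex contains the whole small simplex, by convexity of balls.
  obtain ⟨b, hb⟩ := hball (w 0) trivial
  have hrange : Set.range (σ.comp (comb (convex n) w)) ⊆ if b then U else V := by
    rintro _ ⟨t, rfl⟩
    refine hb ?_
    rw [Metric.mem_ball, dist_comm]
    exact (dist_comb_le (convex n) w t (w 0) _ (hw 0)).trans_lt hm'
  cases b
  · exact Submodule.mem_sup_right (of_mem_chainsIn (by simpa using hrange))
  · exact Submodule.mem_sup_left (of_mem_chainsIn (by simpa using hrange))

theorem subdivision_mem_sup_chainsIn {U V : Set M} {n : ℕ} {x : SingularChain M n}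
    (hx : x ∈ chainsIn U n ⊔ chainsIn V n) : subdivision n x ∈ chainsIn U n ⊔ chainsIn V n := by
  obtain ⟨a, ha, b, hb, rfl⟩ := Submodule.mem_sup.1 hx
  rw [map_add]
  exact Submodule.add_mem_sup (subdivision_mem_chainsIn ha) (subdivision_mem_chainsIn hb)

theorem iterate_subdivision_mem_sup_chainsIn {U V : Set M} {n : ℕ} {x : SingularChain M n}
    (hx : x ∈ chainsIn U n ⊔ chainsIn V n) (m : ℕ) :
    (subdivision n)^[m] x ∈ chainsIn U n ⊔ chainsIn V n := by
  induction m with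
  | zero => exact hx
  | succ m ih =>
    rw [Function.iterate_succ_apply']
    exact subdivision_mem_sup_chainsIn ih

theorem exists_iterate_subdivision_mem {U V : Set M} (hU : IsOpen U) (hV : IsOpen V) {n : ℕ}
    {x : SingularChain M n} (hx : x ∈ chainsIn (U ∪ V) n) :
    ∃ m, (subdivision n)^[m] x ∈ chainsIn U n ⊔ chainsIn V n := by
  have hpow : ∀ m (y : SingularChain M n), (subdivision n)^[m] y = (subdivision n ^ m) y :=
    fun m y => (Module.End.pow_apply _ _ _).symm
  rw [chainsIn, Finsupp.supported_eq_span_single] at hx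
  induction hx using Submodule.span_induction with
  | mem x h =>
    obtain ⟨σ, hσ, rfl⟩ := h
    exact exists_iterate_subdivision_of_mem hU hV hσ
  | zero => exact ⟨0, Submodule.zero_mem _⟩
  | add x y _ _ ihx ihy =>
    obtain ⟨m, hm⟩ := ihx
    obtain ⟨k, hk⟩ := ihy
    -- Further subdivision keeps a chain small, so the sum of the two exponents serves both
    -- summands.
    refine ⟨m + k, ?_⟩
    rw [hpow, map_add, ← hpow, ← hpow]
    refine Submodule.add_mem _ ?_ ?_
    · rw [add_comm m k, Function.iterate_add_apply]
      exact iterate_subdivision_mem_sup_chainsIn hm k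
    · rw [Function.iterate_add_apply]
      exact iterate_subdivision_mem_sup_chainsIn hk m
  | smul c x _ ih =>
    obtain ⟨m, hm⟩ := ih
    refine ⟨m, ?_⟩
    rw [hpow, map_smul, ← hpow]
    exact Submodule.smul_mem _ _ hm

/-- A cycle in the union of two open sets is homologous, within the union, to the sum of a chain
in one of them and a chain in the other. -/
theorem exists_small_chains {U V : Set M} (hU : IsOpen U) (hV : IsOpen V) {n : ℕ}
    {x : SingularChain M n} (hx : x ∈ chainsIn (U ∪ V) n) (hc : x ∈ cycles M n) :
    ∃ a ∈ chainsIn U n, ∃ b ∈ chainsIn V n, x - (a + b) ∈ boundariesIn (U ∪ V) n := by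
  obtain ⟨m, hm⟩ := exists_iterate_subdivision_mem hU hV hx
  obtain ⟨a, ha, b, hb, hab⟩ := Submodule.mem_sup.1 hm
  refine ⟨a, ha, b, hb, ?_⟩
  rw [hab]
  exact sub_iterate_subdivision_mem_boundariesIn m hx hc

end SingularChain

/-! ### Prisms and the contraction of chains in a convex set -/

namespace SingularChain

variable {M : Type*} [TopologicalSpace M] {N : Type*} [TopologicalSpace N]

/-- The prism over the standard simplex. -/
def prism (n : ℕ) : Set ((Fin (n + 1) → ℝ) × ℝ) := stdSimplex ℝ (Fin (n + 1)) ×ˢ Set.Icc 0 1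

theorem convex_prism (n : ℕ) : Convex ℝ (prism n) := (convex n).prod (convex_Icc 0 1)

/-- The inclusion of the bottom (`s = 0`) or the top (`s = 1`) of the prism. -/
def prismIncl (n : ℕ) (s : Set.Icc (0 : ℝ) 1) : C(TopSimplex n, prism n) :=
  ⟨fun t => ⟨(t.1, s.1), t.2, s.2⟩, by fun_prop⟩

/-- The map of prisms induced by the inclusion of a face. -/
def prismFace {n : ℕ} (i : Fin (n + 2)) : C(prism n, prism (n + 1)) :=
  ⟨fun q => ⟨((face i ⟨q.1.1, q.2.1⟩).1, q.1.2), (face i ⟨q.1.1, q.2.1⟩).2, q.2.2⟩, by fun_prop⟩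

theorem isAffine_prismIncl (n : ℕ) (s : Set.Icc (0 : ℝ) 1) :
    IsAffine (convex n) (convex_prism n) (prismIncl n s) := by
  intro m v
  refine ContinuousMap.ext fun t => Subtype.ext (Prod.ext ?_ ?_)
  · rw [coe_comb, Prod.fst_sum]
    rfl
  · rw [coe_comb, Prod.snd_sum]
    change s.1 = ∑ j, t j * s.1
    rw [← Finset.sum_mul, stdSimplex.sum_eq_one, one_mul]

theorem isAffine_prismFace {n : ℕ} (i : Fin (n + 2)) :
    IsAffine (convex_prism n) (convex_prism (n + 1)) (prismFace i) := by
  intro m v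
  refine ContinuousMap.ext fun t => Subtype.ext (Prod.ext ?_ ?_)
  · have h := congrArg Subtype.val (ContinuousMap.congr_fun
      (isAffine_face i m fun j => ⟨(v j).1.1, (v j).2.1⟩) t)
    rw [coe_comb] at h
    rw [coe_comb, Prod.fst_sum]
    refine Eq.trans ?_ h
    change (face i _).1 = (face i _).1
    congr 2
    refine Subtype.ext ?_
    change ((comb (convex_prism n) v t : prism n) : (Fin (n + 1) → ℝ) × ℝ).1 = Subtype.val _
    rw [coe_comb, coe_comb, Prod.fst_sum]
    rfl
  · rw [coe_comb, Prod.snd_sum]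
    change ((comb (convex_prism n) v t : prism n) : (Fin (n + 1) → ℝ) × ℝ).2 = _
    rw [coe_comb, Prod.snd_sum]
    rfl

/-- The chain homotopy between the bottom and the top of the prism, for chains of tuples. -/
def prismHomotopy (n m : ℕ) : TupleChain (TopSimplex n) m →ₗ[ℤ] TupleChain (prism n) (m + 1) :=
  TupleChain.homotopy (TupleChain.map (prismIncl n 0)) (TupleChain.map (prismIncl n 1))
    (prismIncl n 0) m

theorem bd_prismHomotopy (n m : ℕ) (x : TupleChain (TopSimplex n) (m + 1)) :
    TupleChain.bd (m + 1) (prismHomotopy n (m + 1) x) =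
      TupleChain.map (prismIncl n 0) (m + 1) x - TupleChain.map (prismIncl n 1) (m + 1) x -
        prismHomotopy n m (TupleChain.bd m x) :=
  TupleChain.bd_homotopy _ (TupleChain.bd_map _) (TupleChain.bd_map _)
    -- The start of the homotopy: there is only one empty tuple, so bottom and top agree on it.
    (TupleChain.hom_ext fun v => by
      rw [TupleChain.map_of, TupleChain.map_of]
      congr 1
      exact Subsingleton.elim _ _) m x

theorem prismHomotopy_face {n : ℕ} (i : Fin (n + 2)) (m : ℕ) (x : TupleChain (TopSimplex n) m) :
    prismHomotopy (n + 1) m (TupleChain.map (face i) m x) =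
      TupleChain.map (prismFace i) (m + 1) (prismHomotopy n m x) := by
  have h (s) (k) (y : TupleChain (TopSimplex n) k) :
      TupleChain.map (prismIncl (n + 1) s) k (TupleChain.map (face i) k y) =
        TupleChain.map (prismFace i) k (TupleChain.map (prismIncl n s) k y) := by
    have : TupleChain.map (prismIncl (n + 1) s) k ∘ₗ TupleChain.map (face i) k =
        TupleChain.map (prismFace i) k ∘ₗ TupleChain.map (prismIncl n s) k :=
      TupleChain.hom_ext fun v => by
        simp only [LinearMap.comp_apply, TupleChain.map_of]
        rfl
    exact LinearMap.congr_fun this y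
  exact TupleChain.homotopy_map _ _ (h 0) (h 1) (fun _ => rfl) m x

section contraction

variable {E : Type*} [NormedAddCommGroup E] {C : Set E} (c : C)

/-- The chain map that replaces every singular simplex by a constant one. -/
def constChain (n : ℕ) : SingularChain C n →ₗ[ℤ] SingularChain C n :=
  lift fun _ => of (ContinuousMap.const _ c)

theorem constChain_of {n : ℕ} (σ : C(TopSimplex n, C)) :
    constChain c n (of σ) = of (ContinuousMap.const _ c) :=
  lift_of _ _

variable [NormedSpace ℝ E] (hC : Convex ℝ C)

/-- The straight-line homotopy from a singular simplex in a convex set to a constant one. -/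
def straightLine {n : ℕ} (σ : C(TopSimplex n, C)) : C(prism n, C) where
  toFun q := ⟨(1 - q.1.2) • (σ ⟨q.1.1, q.2.1⟩ : E) + q.1.2 • (c : E),
    hC (σ _).2 c.2 (sub_nonneg.2 q.2.2.2) q.2.2.1 (by ring)⟩
  continuous_toFun := by fun_prop

theorem straightLine_zero {n : ℕ} (σ : C(TopSimplex n, C)) :
    (straightLine c hC σ).comp (prismIncl n 0) = σ := by
  ext t
  simp [straightLine, prismIncl]

theorem straightLine_one {n : ℕ} (σ : C(TopSimplex n, C)) :
    (straightLine c hC σ).comp (prismIncl n 1) = ContinuousMap.const _ c := by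
  ext t
  simp [straightLine, prismIncl]

/-- The chain homotopy which contracts the singular chains of a convex set. -/
def contraction (n : ℕ) : SingularChain C n →ₗ[ℤ] SingularChain C (n + 1) :=
  lift fun σ => realize (convex_prism n) (straightLine c hC σ) (n + 1)
    (prismHomotopy n (n + 1) (TupleChain.of (vertices n)))

theorem contraction_of {n : ℕ} (σ : C(TopSimplex n, C)) :
    contraction c hC n (of σ) = realize (convex_prism n) (straightLine c hC σ) (n + 1)
      (prismHomotopy n (n + 1) (TupleChain.of (vertices n))) :=
  lift_of _ _

theorem bd_contraction_of {n : ℕ} (σ : C(TopSimplex n, C)) :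
    bd n (contraction c hC n (of σ)) = of σ - constChain c n (of σ) -
      realize (convex_prism n) (straightLine c hC σ) n
        (prismHomotopy n n (TupleChain.bd n (TupleChain.of (vertices n)))) := by
  rw [contraction_of, bd_realize, bd_prismHomotopy, map_sub, map_sub,
    realize_map (isAffine_prismIncl n 0), realize_map (isAffine_prismIncl n 1), straightLine_zero,
    straightLine_one, realize_vertices, realize_vertices, constChain_of]

theorem bd_contraction_zero (x : SingularChain C 0) :
    bd 0 (contraction c hC 0 x) = x - constChain c 0 x := by
  have : bd 0 ∘ₗ contraction c hC 0 = LinearMap.id - constChain c 0 := hom_ext fun σ => by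
    rw [LinearMap.comp_apply, bd_contraction_of, prismHomotopy, TupleChain.homotopy_zero]
    simp
  exact LinearMap.congr_fun this x

theorem bd_contraction (n : ℕ) (x : SingularChain C (n + 1)) :
    bd (n + 1) (contraction c hC (n + 1) x) =
      x - constChain c (n + 1) x - contraction c hC n (bd n x) := by
  have : bd (n + 1) ∘ₗ contraction c hC (n + 1) =
      LinearMap.id - constChain c (n + 1) - contraction c hC n ∘ₗ bd n := hom_ext fun σ => by
    have key : realize (convex_prism (n + 1)) (straightLine c hC σ) (n + 1)
        (prismHomotopy (n + 1) (n + 1) (TupleChain.bd (n + 1)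
          (TupleChain.of (vertices (n + 1))))) = contraction c hC n (bd n (of σ)) := by
      rw [bd_vertices, bd_of]
      simp only [map_sum, map_smul]
      refine Finset.sum_congr rfl fun i _ => ?_
      congr 1
      rw [contraction_of, prismHomotopy_face, realize_map (isAffine_prismFace i)]
      rfl
    rw [LinearMap.comp_apply, bd_contraction_of, key]
    rfl
  exact LinearMap.congr_fun this x

/-- On a cycle the term of the homotopy formula that involves the boundary vanishes. Hence constant
simplices represent all classes, and the homology of a point need not be computed. -/
theorem exists_eq_add_bd_of_convex (hC : Convex ℝ C) {n : ℕ} {x : SingularChain C n}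
    (hx : x ∈ cycles C n) : ∃ y, x = constChain c n x + bd n y := by
  refine ⟨contraction c hC n x, ?_⟩
  cases n with
  | zero => rw [bd_contraction_zero, add_sub_cancel]
  | succ n =>
    have h : bd n x = 0 := hx
    rw [bd_contraction, h, map_zero, sub_zero, add_sub_cancel]

end contraction

/-! ### Finitely generated images and Mayer–Vietoris -/

/-- The image of `H_n(A)` in `H_n(B)` is finitely generated: up to boundaries in `B`, the cycles in
`A` lie in a finitely generated module. -/
def FGImage (A B : Set M) (n : ℕ) : Prop :=
  ∃ F : Submodule ℤ (SingularChain M n), F.FG ∧ chainsIn A n ⊓ cycles M n ≤ F ⊔ boundariesIn B n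

theorem FGImage.mono {A A' B B' : Set M} {n : ℕ} (h : FGImage A B n) (hA : A' ⊆ A) (hB : B ⊆ B') :
    FGImage A' B' n := by
  obtain ⟨F, hF, h⟩ := h
  exact ⟨F, hF, (inf_le_inf_right _ (chainsIn_mono hA n)).trans
    (h.trans (sup_le_sup_left (boundariesIn_mono hB n) _))⟩

theorem fgImage_empty (B : Set M) (n : ℕ) : FGImage ∅ B n := by
  refine ⟨⊥, Submodule.fg_bot, inf_le_left.trans ?_⟩
  intro x hx
  have h : (LinearMap.id : SingularChain M n →ₗ[ℤ] _) x ∈ (⊥ : Submodule ℤ (SingularChain M n)) :=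
    map_mem_of_mem_chainsIn (fun σ hσ => absurd (hσ ⟨vertices n 0, rfl⟩) (by simp)) hx
  rw [LinearMap.id_apply, Submodule.mem_bot] at h
  rw [h]
  exact Submodule.zero_mem _

theorem cycles_of_map {f : C(M, N)} (hf : Function.Injective f) {n : ℕ} {x : SingularChain M n}
    (h : map f n x ∈ cycles N n) : x ∈ cycles M n := by
  cases n with
  | zero => exact Submodule.mem_top
  | succ n =>
    have hinj : Function.Injective (map f n) := by
      have : ∀ y, map f n y = Finsupp.mapDomain f.comp y := fun y => by
        have : map f n = Finsupp.lmapDomain ℤ ℤ f.comp := hom_ext fun σ => by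
          rw [map_of, Finsupp.lmapDomain_apply, Finsupp.mapDomain_single]
        rw [this, Finsupp.lmapDomain_apply]
      intro y z hyz
      rw [this, this] at hyz
      refine Finsupp.mapDomain_injective (fun σ τ hστ => ?_) hyz
      ext t
      exact hf (ContinuousMap.congr_fun hστ t)
    have h' : bd n (map f (n + 1) x) = 0 := h
    rw [bd_map] at h'
    exact hinj (by rw [h', map_zero])

/-- The homology of a subspace that is homeomorphic to a convex set is finitely generated. -/
theorem fgImage_of_convex {E : Type*} [NormedAddCommGroup E] [NormedSpace ℝ E] {C : Set E}
    (hC : Convex ℝ C) {U : Set M} (f : C(C, M)) (hf : Function.Injective f)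
    (hU : Set.range f ⊆ U)
    (hlift : ∀ (n : ℕ) (σ : C(TopSimplex n, M)), Set.range σ ⊆ U → ∃ τ, f.comp τ = σ) (n : ℕ) :
    FGImage U U n := by
  rcases isEmpty_or_nonempty C with hempty | ⟨⟨c⟩⟩
  · suffices h : U = ∅ by
      rw [h]
      exact fgImage_empty _ _
    refine Set.eq_empty_of_forall_notMem fun x hx => ?_
    obtain ⟨τ, _⟩ := hlift 0 (ContinuousMap.const _ x) (by
      rintro _ ⟨_, rfl⟩
      exact hx)
    exact hempty.false (τ (vertices 0 0))
  -- One constant simplex suffices in each degree. It need not be a cycle, since `FGImage` does not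
  -- ask the finitely generated module to consist of cycles.
  refine ⟨Submodule.span ℤ {of (ContinuousMap.const _ (f c))},
    Submodule.fg_span_singleton _, ?_⟩
  rintro x ⟨hx, hc⟩
  have hrange : chainsIn U n ≤ LinearMap.range (map f n) := fun y hy =>
    map_mem_of_mem_chainsIn (f := LinearMap.id) (fun σ hσ => by
      obtain ⟨τ, rfl⟩ := hlift n σ hσ
      exact ⟨of τ, map_of f τ⟩) hy
  obtain ⟨y, rfl⟩ := hrange hx
  obtain ⟨w, hw⟩ := exists_eq_add_bd_of_convex c hC (cycles_of_map hf hc)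
  rw [hw, map_add, ← bd_map]
  refine Submodule.add_mem_sup ?_ ⟨_, map_mem_chainsIn hU _ _, rfl⟩
  have : LinearMap.range (map f n ∘ₗ constChain c n) ≤
      Submodule.span ℤ {of (ContinuousMap.const _ (f c))} := by
    rintro _ ⟨z, rfl⟩
    induction z using Finsupp.induction_linear with
    | zero => rw [map_zero]; exact Submodule.zero_mem _
    | add z w hz hw => rw [map_add]; exact Submodule.add_mem _ hz hw
    | single σ k =>
      rw [← mul_one k, ← smul_eq_mul, ← Finsupp.smul_single, map_smul, LinearMap.comp_apply,
        constChain_of, map_of]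
      exact Submodule.smul_mem _ _ (Submodule.mem_span_singleton_self _)
  exact this ⟨y, rfl⟩

/-- Lift finitely many generators of `φ(L)` to `L`; subtracting a combination of the lifts moves any
element of `L` into the kernel. -/
theorem exists_fg_sup_inf_ker {A B : Type*} [AddCommGroup A] [AddCommGroup B] (φ : A →ₗ[ℤ] B)
    (L : Submodule ℤ A) (h : (L.map φ).FG) :
    ∃ L₀ : Submodule ℤ A, L₀.FG ∧ L₀ ≤ L ∧ L ≤ L₀ ⊔ (L ⊓ LinearMap.ker φ) := by
  classical
  obtain ⟨s, hs⟩ := h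
  have hsub : (s : Set B) ⊆ φ '' L := by
    rw [← Submodule.map_coe, ← hs]
    exact Submodule.subset_span
  obtain ⟨t, ht, rfl⟩ := Finset.subset_set_image_iff.1 hsub
  have htL : Submodule.span ℤ (t : Set A) ≤ L := Submodule.span_le.2 ht
  refine ⟨Submodule.span ℤ t, ⟨t, rfl⟩, htL, fun a ha => ?_⟩
  have : φ a ∈ (Submodule.span ℤ (t : Set A)).map φ := by
    rw [Submodule.map_span, ← Finset.coe_image, hs]
    exact ⟨a, ha, rfl⟩
  obtain ⟨b, hb, hab⟩ := this
  rw [← add_sub_cancel b a]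
  exact Submodule.add_mem_sup hb ⟨L.sub_mem ha (htL hb), by simp [hab]⟩

/-- The step of the Mayer–Vietoris argument. -/
theorem FGImage.union {A₁ A₂ B₁ B₂ C₁ C₂ : Set M} (hA₁ : IsOpen A₁) (hA₂ : IsOpen A₂)
    (h₁ : A₁ ⊆ B₁) (h₂ : A₂ ⊆ B₂)
    (hinter : ∀ n, FGImage (A₁ ∩ A₂) (B₁ ∩ B₂) n) (hB₁ : ∀ n, FGImage B₁ C₁ n)
    (hB₂ : ∀ n, FGImage B₂ C₂ n) (hAC₁ : A₁ ⊆ C₁) (hAC₂ : A₂ ⊆ C₂) (n : ℕ) :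
    FGImage (A₁ ∪ A₂) (C₁ ∪ C₂) n := by
  obtain ⟨F₁, hF₁, hle₁⟩ := hB₁ n
  obtain ⟨F₂, hF₂, hle₂⟩ := hB₂ n
  have hC₁ : boundariesIn C₁ n ≤ boundariesIn (C₁ ∪ C₂) n :=
    boundariesIn_mono Set.subset_union_left n
  have hC₂ : boundariesIn C₂ n ≤ boundariesIn (C₁ ∪ C₂) n :=
    boundariesIn_mono Set.subset_union_right n
  have hA : boundariesIn (A₁ ∪ A₂) n ≤ boundariesIn (C₁ ∪ C₂) n :=
    boundariesIn_mono (Set.union_subset_union hAC₁ hAC₂) n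
  have hsum : ∀ a ∈ chainsIn B₁ n, ∀ b ∈ chainsIn B₂ n, a ∈ cycles M n → b ∈ cycles M n →
      a + b ∈ F₁ ⊔ F₂ ⊔ boundariesIn (C₁ ∪ C₂) n := fun a ha b hb hac hbc =>
    Submodule.add_mem _
      (sup_le_sup le_sup_left hC₁ (hle₁ ⟨ha, hac⟩))
      (sup_le_sup le_sup_right hC₂ (hle₂ ⟨hb, hbc⟩))
  -- In degree `0` every chain is a cycle, so both summands of a small chain can be used directly
  -- and no connecting map is needed.
  cases n with
  | zero =>
    refine ⟨F₁ ⊔ F₂, hF₁.sup hF₂, ?_⟩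
    rintro x ⟨hx, hc⟩
    obtain ⟨a, ha, b, hb, hab⟩ := exists_small_chains hA₁ hA₂ hx hc
    rw [← add_sub_cancel (a + b) x]
    exact Submodule.add_mem _ (hsum a (chainsIn_mono h₁ _ ha) b (chainsIn_mono h₂ _ hb)
      Submodule.mem_top Submodule.mem_top) (Submodule.mem_sup_right (hA hab))
  | succ n =>
    obtain ⟨F, hF, hle⟩ := hinter n
    let add : SingularChain M (n + 1) × SingularChain M (n + 1) →ₗ[ℤ] SingularChain M (n + 1) :=
      LinearMap.fst ℤ _ _ + LinearMap.snd ℤ _ _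
    let L : Submodule ℤ (SingularChain M (n + 1) × SingularChain M (n + 1)) :=
      (chainsIn A₁ (n + 1)).prod (chainsIn A₂ (n + 1)) ⊓ LinearMap.ker (bd n ∘ₗ add)
    -- The connecting homomorphism: a pair `(a, b)` with `a + b` a cycle goes to `∂a = -∂b`, a cycle
    -- in `A₁ ∩ A₂`, modulo boundaries in `B₁ ∩ B₂`. Its image is finitely generated by `hinter`, as
    -- `ℤ` is Noetherian.
    let φ := (boundariesIn (B₁ ∩ B₂) n).mkQ ∘ₗ bd n ∘ₗ
      LinearMap.fst ℤ (SingularChain M (n + 1)) (SingularChain M (n + 1))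
    have hbd : ∀ p ∈ L, bd n p.2 = - bd n p.1 := fun p hp => by
      have : bd n (p.1 + p.2) = 0 := hp.2
      rw [map_add] at this
      exact eq_neg_of_add_eq_zero_right this
    have hφ : (L.map φ).FG := by
      refine Submodule.FG.of_le (hF.map (boundariesIn (B₁ ∩ B₂) n).mkQ) ?_
      rintro _ ⟨p, hp, rfl⟩
      have h2 : bd n p.1 ∈ chainsIn A₂ n := by
        rw [← neg_neg (bd n p.1), ← hbd p hp]
        exact Submodule.neg_mem _ (bd_mem_chainsIn hp.1.2)
      obtain ⟨f, hf, g, hg, hfg⟩ := Submodule.mem_sup.1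
        (hle ⟨mem_chainsIn_inter (bd_mem_chainsIn hp.1.1) h2, bd_mem_cycles _⟩)
      refine ⟨f, hf, ?_⟩
      change _ = (boundariesIn (B₁ ∩ B₂) n).mkQ (bd n p.1)
      rw [← hfg, map_add, Submodule.mkQ_apply _ g, (Submodule.Quotient.mk_eq_zero _).2 hg, add_zero]
    obtain ⟨L₀, hL₀, hL₀L, hL⟩ := exists_fg_sup_inf_ker φ L hφ
    refine ⟨L₀.map add ⊔ (F₁ ⊔ F₂), (hL₀.map _).sup (hF₁.sup hF₂), ?_⟩
    rw [sup_assoc]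
    rintro x ⟨hx, hc⟩
    obtain ⟨a, ha, b, hb, hab⟩ := exists_small_chains hA₁ hA₂ hx hc
    rw [← add_sub_cancel (a + b) x]
    refine Submodule.add_mem _ ?_ (Submodule.mem_sup_right (Submodule.mem_sup_right (hA hab)))
    have habL : (a, b) ∈ L := by
      refine ⟨⟨ha, hb⟩, ?_⟩
      have h := Submodule.sub_mem _ hc (boundariesIn_le_cycles _ _ hab)
      rw [sub_sub_cancel] at h
      exact h
    obtain ⟨l, hl, p, ⟨hpL, hp⟩, hlp⟩ := Submodule.mem_sup.1 (hL habL)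
    have : a + b = add l + add p := by
      rw [← map_add, hlp]
      rfl
    rw [this]
    refine Submodule.add_mem_sup ⟨l, hl, rfl⟩ ?_
    -- A pair in the kernel has `∂p.1 = ∂c` with `c` in `B₁ ∩ B₂`; then `p.1 - c` and `p.2 + c` are
    -- cycles in `B₁` and `B₂` with the same sum.
    obtain ⟨c, hc', hcp⟩ : bd n p.1 ∈ boundariesIn (B₁ ∩ B₂) n :=
      (Submodule.Quotient.mk_eq_zero _).1 hp
    have hp' : add p = (p.1 - c) + (p.2 + c) := by
      change p.1 + p.2 = _
      abel
    rw [hp']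
    refine hsum _ ?_ _ ?_ ?_ ?_
    · exact Submodule.sub_mem _ (chainsIn_mono h₁ _ hpL.1.1)
        (chainsIn_mono Set.inter_subset_left _ hc')
    · exact Submodule.add_mem _ (chainsIn_mono h₂ _ hpL.1.2)
        (chainsIn_mono Set.inter_subset_right _ hc')
    · change bd n (p.1 - c) = 0
      rw [map_sub, hcp, sub_self]
    · change bd n (p.2 + c) = 0
      rw [map_add, hbd p hpL, hcp, neg_add_cancel]

end SingularChain

/-! ### Finite generation for compact manifolds -/

namespace SingularChain

variable {M : Type*} [TopologicalSpace M]

section chart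

variable {E : Type*} [NormedAddCommGroup E] [NormedSpace ℝ E]

theorem fgImage_chart_of_convex (e : OpenPartialHomeomorph M E) {C : Set E} (hC : Convex ℝ C)
    (hCe : C ⊆ e.target) (n : ℕ) : FGImage (e.source ∩ e ⁻¹' C) (e.source ∩ e ⁻¹' C) n := by
  refine fgImage_of_convex hC
    ⟨fun x => e.symm x, e.continuousOn_symm.comp_continuous continuous_subtype_val
      fun x => hCe x.2⟩ ?_ ?_ (fun n σ hσ => ?_) n
  · intro x y hxy
    exact Subtype.ext (e.symm.injOn (hCe x.2) (hCe y.2) hxy)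
  · rintro _ ⟨x, rfl⟩
    refine ⟨e.map_target (hCe x.2), ?_⟩
    simp [e.right_inv (hCe x.2)]
  · have hσ' : ∀ t, σ t ∈ e.source ∩ e ⁻¹' C := fun t => hσ ⟨t, rfl⟩
    refine ⟨⟨fun t => ⟨e (σ t), (hσ' t).2⟩, Continuous.subtype_mk
      (e.continuousOn.comp_continuous σ.continuous fun t => (hσ' t).1) _⟩, ?_⟩
    ext t
    exact e.left_inv (hσ' t).1

/-- Induction on the number of convex sets. The intersection of `C a` with the union of the others
is a union of the convex sets `C a ∩ C i`, so the induction must run over all families `C`. -/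
theorem fgImage_chart_biUnion (e : OpenPartialHomeomorph M E) {ι : Type*} (s : Finset ι)
    (C : ι → Set E) (hC : ∀ i ∈ s, Convex ℝ (C i)) (hCo : ∀ i ∈ s, IsOpen (C i))
    (hCe : ∀ i ∈ s, C i ⊆ e.target) (n : ℕ) :
    FGImage (e.source ∩ e ⁻¹' ⋃ i ∈ s, C i) (e.source ∩ e ⁻¹' ⋃ i ∈ s, C i) n := by
  classical
  induction s using Finset.induction_on generalizing C n with
  | empty => simpa using fgImage_empty ∅ n
  | insert a s ha ih =>
    simp only [Finset.mem_insert, forall_eq_or_imp] at hC hCo hCe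
    have h1 := fgImage_chart_of_convex e hC.1 hCe.1
    have h2 := ih C hC.2 hCo.2 hCe.2
    have h12 := ih (fun i => C a ∩ C i) (fun i hi => hC.1.inter (hC.2 i hi))
      (fun i hi => hCo.1.inter (hCo.2 i hi)) (fun i hi => Set.inter_subset_left.trans hCe.1)
    have hopen : ∀ {V : Set E}, IsOpen V → IsOpen (e.source ∩ e ⁻¹' V) :=
      fun hV => e.isOpen_inter_preimage hV
    have hinter : e.source ∩ e ⁻¹' (⋃ i ∈ s, C a ∩ C i) =
        (e.source ∩ e ⁻¹' C a) ∩ (e.source ∩ e ⁻¹' ⋃ i ∈ s, C i) := by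
      rw [← Set.inter_iUnion₂, Set.preimage_inter, Set.inter_inter_distrib_left]
    rw [hinter] at h12
    have hunion : e.source ∩ e ⁻¹' (⋃ i ∈ insert a s, C i) =
        (e.source ∩ e ⁻¹' C a) ∪ (e.source ∩ e ⁻¹' ⋃ i ∈ s, C i) := by
      rw [Finset.set_biUnion_insert, Set.preimage_union, Set.inter_union_distrib_left]
    rw [hunion]
    exact FGImage.union (hopen hCo.1) (hopen (isOpen_biUnion hCo.2)) subset_rfl subset_rfl
      h12 h1 h2 subset_rfl subset_rfl n

end chart

/-- For every open subset `W` of `U` and every subset of `W` whose closure lies in `W`, the image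
in the homology of `W` is finitely generated. -/
def LocallyFG (U : Set M) : Prop :=
  ∀ W : Set M, IsOpen W → W ⊆ U → ∀ A : Set M, closure A ⊆ W → ∀ n, FGImage A W n

theorem LocallyFG.mono {U V : Set M} (h : LocallyFG V) (hUV : U ⊆ V) : LocallyFG U :=
  fun W hW hWU => h W hW (hWU.trans hUV)

/-- Finitely many balls in the chart cover the compact set `closure A` and stay inside `W`, so the
map on homology factors through that of a finite union of convex sets. -/
theorem locallyFG_chart [CompactSpace M] {E : Type*} [NormedAddCommGroup E] [NormedSpace ℝ E]
    (e : OpenPartialHomeomorph M E) : LocallyFG e.source := by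
  intro W hW hWe A hA n
  have hcomp : IsCompact (e '' closure A) :=
    isClosed_closure.isCompact.image_of_continuousOn (e.continuousOn.mono (hA.trans hWe))
  have hWo : IsOpen (e.target ∩ e.symm ⁻¹' W) := e.isOpen_inter_preimage_symm hW
  have hr : ∀ y ∈ e '' closure A, ∃ r > 0, Metric.ball y r ⊆ e.target ∩ e.symm ⁻¹' W := by
    rintro _ ⟨x, hx, rfl⟩
    refine Metric.isOpen_iff.1 hWo _ ⟨e.map_source (hWe (hA hx)), ?_⟩
    simpa [e.left_inv (hWe (hA hx))] using hA hx
  choose! r hr0 hr using hr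
  obtain ⟨t, ht, hcover⟩ := hcomp.elim_nhds_subcover (fun y => Metric.ball y (r y))
    fun y hy => Metric.ball_mem_nhds y (hr0 y hy)
  refine (fgImage_chart_biUnion e t (fun y => Metric.ball y (r y))
    (fun y _ => convex_ball _ _) (fun y _ => Metric.isOpen_ball)
    (fun y hy => (hr y (ht y hy)).trans Set.inter_subset_left) n).mono ?_ ?_
  · intro x hx
    exact ⟨hWe (hA (subset_closure hx)), hcover ⟨x, subset_closure hx, rfl⟩⟩
  · rintro x ⟨hx, hxt⟩
    obtain ⟨y, hy, hxy⟩ := Set.mem_iUnion₂.1 hxt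
    have := (hr y (ht y hy) hxy).2
    rwa [Set.mem_preimage, e.left_inv hx] at this

theorem LocallyFG.union [NormalSpace M] {U V : Set M} (hUo : IsOpen U) (hVo : IsOpen V)
    (hU : LocallyFG U) (hV : LocallyFG V) : LocallyFG (U ∪ V) := by
  intro W hW hWUV A hA n
  have hW1 : IsOpen (W ∩ U) := hW.inter hUo
  have hW2 : IsOpen (W ∩ V) := hW.inter hVo
  have hWeq : W ∩ U ∪ W ∩ V = W := by
    rw [← Set.inter_union_distrib_left, Set.inter_eq_left.2 hWUV]
  -- `A₁` takes the part of `closure A` outside `V` and `A₂` the part outside `A₁`. The sets `B₁`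
  -- and `B₂` leave room between `closure A₁`, `closure A₂` and `W ∩ U`, `W ∩ V` for the
  -- Mayer–Vietoris step.
  obtain ⟨A₁, hA₁, hsub₁, hcl₁⟩ := normal_exists_closure_subset
    (isClosed_closure.sdiff hW2 : IsClosed (closure A \ (W ∩ V))) hW1 (fun x hx =>
      (hWeq.symm ▸ hA hx.1 : x ∈ W ∩ U ∪ W ∩ V).resolve_right hx.2)
  obtain ⟨A₂, hA₂, hsub₂, hcl₂⟩ := normal_exists_closure_subset
    (isClosed_closure.sdiff hA₁ : IsClosed (closure A \ A₁)) hW2 (fun x hx =>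
      by_contra fun h => hx.2 (hsub₁ ⟨hx.1, h⟩))
  obtain ⟨B₁, hB₁, hAB₁, hBW₁⟩ := normal_exists_closure_subset isClosed_closure hW1 hcl₁
  obtain ⟨B₂, hB₂, hAB₂, hBW₂⟩ := normal_exists_closure_subset isClosed_closure hW2 hcl₂
  have hA12 : A ⊆ A₁ ∪ A₂ := fun x hx =>
    or_iff_not_imp_left.2 fun h => hsub₂ ⟨subset_closure hx, h⟩
  refine (FGImage.union hA₁ hA₂ (subset_closure.trans hAB₁) (subset_closure.trans hAB₂)
    (fun m => ?_) (fun m => hU (W ∩ U) hW1 Set.inter_subset_right B₁ hBW₁ m)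
    (fun m => hV (W ∩ V) hW2 Set.inter_subset_right B₂ hBW₂ m)
    (subset_closure.trans hcl₁) (subset_closure.trans hcl₂) n).mono hA12 hWeq.le
  -- The intersection is again an open subset of `U`; this is why `LocallyFG` quantifies over all
  -- open subsets.
  exact hU (B₁ ∩ B₂) (hB₁.inter hB₂) (Set.inter_subset_left.trans
    (subset_closure.trans (hBW₁.trans Set.inter_subset_right))) _
    ((closure_inter_subset_inter_closure _ _).trans (Set.inter_subset_inter hAB₁ hAB₂)) m

/-- The singular homology of a compact topological manifold is finitely generated. -/
theorem fgImage_univ {E : Type*} [NormedAddCommGroup E] [NormedSpace ℝ E] [CompactSpace M]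
    [T2Space M] [ChartedSpace E M] (n : ℕ) : FGImage (Set.univ : Set M) Set.univ n := by
  have h : ∃ U : Set M, IsOpen U ∧ Set.univ ⊆ U ∧ LocallyFG U := by
    refine isCompact_univ.induction_on (p := fun s => ∃ U, IsOpen U ∧ s ⊆ U ∧ LocallyFG U)
      ?_ ?_ ?_ ?_
    · refine ⟨∅, isOpen_empty, subset_rfl, fun W _ hWU A hA n => ?_⟩
      have hA' : A = ∅ := Set.subset_empty_iff.1 (subset_closure.trans (hA.trans hWU))
      rw [hA']
      exact fgImage_empty _ _
    · rintro s t hst ⟨U, hU, htU, h⟩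
      exact ⟨U, hU, hst.trans htU, h⟩
    · rintro s t ⟨U, hU, hsU, h⟩ ⟨V, hV, htV, h'⟩
      exact ⟨U ∪ V, hU.union hV, Set.union_subset_union hsU htV, h.union hU hV h'⟩
    · intro x _
      exact ⟨(chartAt E x).source, mem_nhdsWithin_of_mem_nhds
        ((chartAt E x).open_source.mem_nhds (mem_chart_source E x)), (chartAt E x).source,
        (chartAt E x).open_source, subset_rfl, locallyFG_chart _⟩
  obtain ⟨U, _, hU, h⟩ := h
  exact h.mono hU Set.univ isOpen_univ subset_rfl Set.univ (Set.subset_univ _) n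

end SingularChain

/-! ### Comparison with Mathlib's singular homology -/

namespace SingularChain

variable (M : Type u) [TopologicalSpace M]

/-- The coefficients. -/
abbrev coeff : ModuleCat.{u} ℤ := ModuleCat.of ℤ (ULift.{u} ℤ)

/-- Mathlib's singular chain complex. -/
abbrev complex : ChainComplex (ModuleCat.{u} ℤ) ℕ :=
  (TopCat.toSSet.obj (TopCat.of M)).chainComplex coeff

open Simplicial

variable {M} in
/-- The element of Mathlib's singular chain complex given by a simplex. -/
def basisElement {n : ℕ} (x : (TopCat.toSSet.obj (TopCat.of M)) _⦋n⦌) : (complex M).X n :=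
  (SSet.ιChainComplex (R := coeff) _ x).hom (ULift.up 1)

/-- Simplices of the singular simplicial set as continuous maps. -/
def simplexEquiv (n : ℕ) : (TopCat.toSSet.obj (TopCat.of M)) _⦋n⦌ ≃ C(TopSimplex n, M) :=
  TopCat.toSSetObjEquiv (TopCat.of M) (Opposite.op ⦋n⦌)

variable {M}

theorem simplexEquiv_δ {n : ℕ} (x : (TopCat.toSSet.obj (TopCat.of M)) _⦋n + 1⦌) (i : Fin (n + 2)) :
    simplexEquiv M n ((TopCat.toSSet.obj (TopCat.of M)).δ i x) =
      (simplexEquiv M (n + 1) x).comp (face i) := by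
  rfl

theorem d_basisElement {n : ℕ} (x : (TopCat.toSSet.obj (TopCat.of M)) _⦋n + 1⦌) :
    ((complex M).d (n + 1) n).hom (basisElement x) =
      ∑ i : Fin (n + 2), (-1 : ℤ) ^ (i : ℕ) •
        basisElement ((TopCat.toSSet.obj (TopCat.of M)).δ i x) := by
  have h := congrArg (fun f => f.hom (ULift.up 1 : ULift.{u} ℤ))
    (SSet.ιChainComplex_d (R := coeff) (TopCat.toSSet.obj (TopCat.of M)) x)
  simp only [ModuleCat.hom_sum, LinearMap.sum_apply, ModuleCat.hom_smul, LinearMap.smul_apply] at h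
  exact h

theorem complex_hom_ext {n : ℕ} {A : Type u} [AddCommGroup A] [Module ℤ A]
    {f g : (complex M).X n →ₗ[ℤ] A} (h : ∀ x, f (basisElement x) = g (basisElement x)) : f = g := by
  have : ModuleCat.ofHom f = ModuleCat.ofHom g := SSet.chainComplex_hom_ext fun x => by
    refine ModuleCat.hom_ext (LinearMap.ext fun r => ?_)
    have hr : r = r.down • (ULift.up 1 : ULift.{u} ℤ) := by
      ext
      simp
    rw [hr, map_zsmul, map_zsmul]
    exact congrArg _ (h x)
  exact congrArg ModuleCat.Hom.hom this

variable (M) in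
/-- The comparison map from Mathlib's singular chains. -/
def ofComplex (n : ℕ) : (complex M).X n →ₗ[ℤ] SingularChain M n :=
  (Limits.Cofan.IsColimit.desc
    ((TopCat.toSSet.obj (TopCat.of M)).isColimitChainComplexXCofan coeff n)
    (fun x => (ModuleCat.ofHom ((LinearMap.toSpanSingleton ℤ _ (of (simplexEquiv M n x))).comp
      (ULift.moduleEquiv (R := ℤ) (M := ℤ)).toLinearMap) :
        coeff ⟶ ModuleCat.of ℤ (SingularChain M n)))).hom

theorem ofComplex_basisElement {n : ℕ} (x : (TopCat.toSSet.obj (TopCat.of M)) _⦋n⦌) :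
    ofComplex M n (basisElement x) = of (simplexEquiv M n x) := by
  have h := congrArg (fun f => f.hom (ULift.up 1 : ULift.{u} ℤ)) (Limits.Cofan.IsColimit.fac
    ((TopCat.toSSet.obj (TopCat.of M)).isColimitChainComplexXCofan coeff n)
    (fun x => (ModuleCat.ofHom ((LinearMap.toSpanSingleton ℤ _ (of (simplexEquiv M n x))).comp
      (ULift.moduleEquiv (R := ℤ) (M := ℤ)).toLinearMap) :
        coeff ⟶ ModuleCat.of ℤ (SingularChain M n))) x)
  refine Eq.trans h ?_
  simp

variable (M) in
/-- The comparison map to Mathlib's singular chains. -/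
def toComplex (n : ℕ) : SingularChain M n →ₗ[ℤ] (complex M).X n :=
  lift fun σ => basisElement ((simplexEquiv M n).symm σ)

theorem toComplex_of {n : ℕ} (σ : C(TopSimplex n, M)) :
    toComplex M n (of σ) = basisElement ((simplexEquiv M n).symm σ) :=
  lift_of _ _

theorem toComplex_ofComplex {n : ℕ} (x : (complex M).X n) :
    toComplex M n (ofComplex M n x) = x := by
  have : toComplex M n ∘ₗ ofComplex M n = LinearMap.id := complex_hom_ext fun x => by
    rw [LinearMap.comp_apply, ofComplex_basisElement, toComplex_of, Equiv.symm_apply_apply,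
      LinearMap.id_apply]
  exact LinearMap.congr_fun this x

theorem bd_ofComplex {n : ℕ} (x : (complex M).X (n + 1)) :
    bd n (ofComplex M (n + 1) x) = ofComplex M n (((complex M).d (n + 1) n).hom x) := by
  have : bd n ∘ₗ ofComplex M (n + 1) = ofComplex M n ∘ₗ ((complex M).d (n + 1) n).hom :=
    complex_hom_ext fun x => by
      rw [LinearMap.comp_apply, ofComplex_basisElement, bd_of, LinearMap.comp_apply,
        d_basisElement, map_sum]
      refine Finset.sum_congr rfl fun i _ => ?_
      rw [map_zsmul, ofComplex_basisElement, simplexEquiv_δ]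
  exact LinearMap.congr_fun this x

theorem d_toComplex {n : ℕ} (x : SingularChain M (n + 1)) :
    ((complex M).d (n + 1) n).hom (toComplex M (n + 1) x) = toComplex M n (bd n x) := by
  have : ((complex M).d (n + 1) n).hom ∘ₗ toComplex M (n + 1) = toComplex M n ∘ₗ bd n :=
    hom_ext fun σ => by
      rw [LinearMap.comp_apply, toComplex_of, d_basisElement, LinearMap.comp_apply, bd_of,
        map_sum]
      refine Finset.sum_congr rfl fun i _ => ?_
      rw [map_zsmul, toComplex_of]
      rfl
  exact LinearMap.congr_fun this x

theorem ofComplex_mem_cycles {n : ℕ} (c : (complex M).cycles n) :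
    ofComplex M n (((complex M).iCycles n).hom c) ∈ cycles M n := by
  cases n with
  | zero => exact Submodule.mem_top
  | succ n =>
    change bd n _ = 0
    rw [bd_ofComplex]
    have h : ((complex M).d (n + 1) n).hom (((complex M).iCycles (n + 1)).hom c) = 0 :=
      congrArg (fun f => f.hom c) ((complex M).iCycles_d (n + 1) n)
    rw [h, map_zero]

/-- Modulo boundaries every cycle lies in the image of `F`, so the cycles that `iCycles` sends into
that image already surject onto homology, and they form a finitely generated module since `ℤ` is
Noetherian. Only `toComplex ∘ ofComplex = id` is needed, not the other composite. -/
theorem finite_homology {n : ℕ} (h : FGImage (Set.univ : Set M) Set.univ n) :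
    Module.Finite ℤ ((complex M).homology n) := by
  obtain ⟨F, hF, hle⟩ := h
  have hinj : Function.Injective ((complex M).iCycles n).hom :=
    (ModuleCat.mono_iff_injective _).1 inferInstance
  have hsurj : Function.Surjective ((complex M).homologyπ n).hom :=
    (ModuleCat.epi_iff_surjective _).1 inferInstance
  let G := (F.map (toComplex M n)).comap ((complex M).iCycles n).hom
  have hG : G.FG := by
    refine Submodule.fg_of_fg_map_injective _ hinj ?_
    exact Submodule.FG.of_le (hF.map _) (Submodule.map_comap_le _ _)
  refine Module.Finite.of_fg_top ?_
  suffices h : G.map ((complex M).homologyπ n).hom = ⊤ from h ▸ hG.map _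
  refine Submodule.eq_top_iff'.2 fun y => ?_
  obtain ⟨c, rfl⟩ := hsurj y
  obtain ⟨f, hf, _, ⟨w, _, rfl⟩, hfw⟩ := Submodule.mem_sup.1
    (hle ⟨by rw [chainsIn_univ]; trivial, ofComplex_mem_cycles c⟩)
  refine ⟨c - ((complex M).toCycles (n + 1) n).hom (toComplex M (n + 1) w), ?_, ?_⟩
  · change ((complex M).iCycles n).hom _ ∈ F.map (toComplex M n)
    have h : ((complex M).iCycles n).hom
        (((complex M).toCycles (n + 1) n).hom (toComplex M (n + 1) w)) =
          toComplex M n (bd n w) := by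
      rw [← d_toComplex]
      exact congrArg (fun f => f.hom (toComplex M (n + 1) w))
        ((complex M).toCycles_i (n + 1) n)
    rw [map_sub, h, ← toComplex_ofComplex (((complex M).iCycles n).hom c), ← hfw, map_add,
      add_sub_cancel_right]
    exact ⟨f, hf, rfl⟩
  · rw [map_sub]
    have h : ((complex M).homologyπ n).hom
        (((complex M).toCycles (n + 1) n).hom (toComplex M (n + 1) w)) = 0 :=
      congrArg (fun f => f.hom (toComplex M (n + 1) w))
        ((complex M).toCycles_comp_homologyπ (n + 1) n)
    rw [h, sub_zero]

end SingularChain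

theorem finite_singularHomology {k : ℕ} (M : Type u) [TopologicalSpace M] [T2Space M]
    [CompactSpace M] [ChartedSpace (EuclideanSpace ℝ (Fin k)) M] (n : ℕ) :
    Module.Finite ℤ (((AlgebraicTopology.singularHomologyFunctor (ModuleCat.{u} ℤ) n).obj
      (ModuleCat.of ℤ (ULift.{u} ℤ))).obj (TopCat.of M)) :=
  SingularChain.finite_homology
    (SingularChain.fgImage_univ (E := EuclideanSpace ℝ (Fin k)) n)

/-! ### Actions of `ℚ` on finitely generated abelian groups -/

section residual

/-- An element of a finitely generated abelian group that is divisible by every nonzero integer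
vanishes. -/
theorem eq_zero_of_forall_exists_zsmul {A : Type*} [AddCommGroup A] [Module.Finite ℤ A] {x : A}
    (h : ∀ m : ℤ, m ≠ 0 → ∃ y, m • y = x) : x = 0 := by
  -- Krull's intersection theorem for the ideal `(m)`.
  have key : ∀ m : ℤ, m ≠ 0 → ∃ s : ℤ, (s * m) • x = x := fun m hm => by
    have hx : x ∈ (⨅ i : ℕ, Ideal.span {m} ^ i • ⊤ : Submodule ℤ A) := by
      refine Submodule.mem_iInf _ |>.2 fun i => ?_
      obtain ⟨y, rfl⟩ := h (m ^ i) (pow_ne_zero _ hm)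
      exact Submodule.smul_mem_smul (Ideal.pow_mem_pow (Ideal.mem_span_singleton_self m) i)
        Submodule.mem_top
    obtain ⟨⟨r, hr⟩, hrx⟩ := (Ideal.mem_iInf_smul_pow_eq_bot_iff _ x).1 hx
    obtain ⟨s, rfl⟩ := Ideal.mem_span_singleton'.1 hr
    exact ⟨s, hrx⟩
  -- With `m = 2`, `x` is killed by the odd, hence nonzero, integer `2s - 1`; taking that integer as
  -- `m` writes `x` as a multiple of `0`.
  obtain ⟨s, hs⟩ := key 2 two_ne_zero
  have hN : (s * 2 - 1) • x = 0 := by rw [sub_smul, hs, one_smul, sub_self]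
  obtain ⟨t, ht⟩ := key (s * 2 - 1) (by omega)
  rw [← ht, mul_smul, hN, smul_zero]

/-- Every homomorphism from `ℚ` to a finite group is trivial. -/
theorem MonoidHom.eq_one_of_finite {H : Type*} [Group H] [Finite H] (φ : Multiplicative ℚ →* H)
    (q : Multiplicative ℚ) : φ q = 1 := by
  have hN : (Nat.card H : ℚ) ≠ 0 := Nat.cast_ne_zero.2 Nat.card_pos.ne'
  have : q = Multiplicative.ofAdd (q.toAdd / Nat.card H) ^ Nat.card H := by
    rw [← ofAdd_nsmul, nsmul_eq_mul, mul_div_cancel₀ _ hN, ofAdd_toAdd]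
  rw [this, map_pow, pow_card_eq_one']

/-- The endomorphism of `A / mA` induced by an endomorphism of `A`. -/
def endQuotient (A : Type*) [AddCommGroup A] (m : ℤ) :
    AddMonoid.End A →* AddMonoid.End (A ⧸ (zsmulAddGroupHom m : A →+ A).range) where
  toFun f := QuotientAddGroup.map _ _ f (by
    rintro _ ⟨y, rfl⟩
    exact ⟨f y, (map_zsmul f m y).symm⟩)
  map_one' := by
    refine AddMonoidHom.ext fun x => ?_
    induction x using QuotientAddGroup.induction_on with
    | H y => rfl
  map_mul' f g := by
    refine AddMonoidHom.ext fun x => ?_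
    induction x using QuotientAddGroup.induction_on with
    | H y => rfl

theorem finite_quotient_zsmul (A : Type*) [AddCommGroup A] [Module.Finite ℤ A] {m : ℤ}
    (hm : m ≠ 0) : Finite (A ⧸ (zsmulAddGroupHom m : A →+ A).range) := by
  have : Module.Finite ℤ (A ⧸ (zsmulAddGroupHom m : A →+ A).range) :=
    Module.Finite.of_surjective
      (QuotientAddGroup.mk' (zsmulAddGroupHom m : A →+ A).range).toIntLinearMap
      (QuotientAddGroup.mk'_surjective _)
  refine Module.finite_of_fg_torsion _ fun x => ?_
  induction x using QuotientAddGroup.induction_on with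
  | H y =>
    refine ⟨⟨m, mem_nonZeroDivisors_of_ne_zero hm⟩, ?_⟩
    exact (QuotientAddGroup.eq_zero_iff _).2 ⟨y, rfl⟩

/-- The additive group `ℚ` acts trivially on every finitely generated abelian group. -/
theorem rat_action_trivial {A : Type*} [AddCommGroup A] [Module.Finite ℤ A]
    (φ : Multiplicative ℚ →* AddMonoid.End A) (q : Multiplicative ℚ) : φ q = 1 := by
  ext a
  refine sub_eq_zero.1 (eq_zero_of_forall_exists_zsmul fun m hm => ?_)
  -- Since `A / mA` is finite, `ℚ` acts on it through the units of a finite monoid, hence trivially;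
  -- so `φ q a - a` lies in `mA`.
  have := finite_quotient_zsmul A hm
  have : Finite (AddMonoid.End (A ⧸ (zsmulAddGroupHom m : A →+ A).range)) :=
    DFunLike.finite _
  have h := congrArg Units.val (MonoidHom.eq_one_of_finite
    (MonoidHom.toHomUnits ((endQuotient A m).comp φ)) q)
  have h' : (φ q a : A ⧸ (zsmulAddGroupHom m : A →+ A).range) = (a : A) :=
    DFunLike.congr_fun h (a : A ⧸ (zsmulAddGroupHom m : A →+ A).range)
  exact (QuotientAddGroup.eq_iff_sub_mem).1 h'

end residual

/-! ### Transvections in the special linear group -/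

section specialLinear

open Matrix Matrix.SpecialLinearGroup

variable {ι : Type*} [Fintype ι] [DecidableEq ι]

/-- The classical `h(a) = w(a) w(-1)` with `w(a) = e_ij(a) e_ji(-a⁻¹) e_ij(a)`. -/
theorem diag2n_eq_mul_transvection {F : Type*} [Field F] {i j : ι} (hij : i ≠ j) (a : F)
    (ha : a ≠ 0) :
    diag2n hij a ha = SpecialLinearGroup.transvection hij a *
      SpecialLinearGroup.transvection hij.symm (-a⁻¹) * SpecialLinearGroup.transvection hij a *
      SpecialLinearGroup.transvection hij (-1) * SpecialLinearGroup.transvection hij.symm 1 *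
      SpecialLinearGroup.transvection hij (-1) := by
  have h : (diag2n hij a ha).1 = 1 + single i i (a - 1) + single j j (a⁻¹ - 1) := by
    ext k l
    rw [diag2n_coe, diagonal_apply]
    simp only [Matrix.add_apply, one_apply, single_apply]
    grind
  refine Subtype.ext (h.trans ?_)
  change _ = (1 + single i j a) * (1 + single j i (-a⁻¹)) * (1 + single i j a) *
    (1 + single i j (-1)) * (1 + single j i 1) * (1 + single i j (-1))
  simp only [mul_add, add_mul, one_mul, mul_one,
    single_mul_single_same, single_mul_single_of_ne _ _ _ _ hij,
    single_mul_single_of_ne _ _ _ _ hij.symm, add_zero]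
  ext k l
  simp only [Matrix.add_apply, single_apply]
  split_ifs <;> field_simp <;> ring

theorem specialLinearGroup_transvection_induction [Nontrivial ι] {F : Type*} [Field F]
    (P : SpecialLinearGroup ι F → Prop)
    (ht : ∀ (i j : ι) (hij : i ≠ j) (a : F), P (SpecialLinearGroup.transvection hij a))
    (hmul : ∀ A B, P A → P B → P (A * B)) (g : SpecialLinearGroup ι F) : P g := by
  refine diagonal_transvection_induction' P g (fun i j hij c hc => ?_) ht hmul
  rw [diag2n_eq_mul_transvection]
  exact hmul _ _ (hmul _ _ (hmul _ _ (hmul _ _ (hmul _ _ (ht _ _ _ _) (ht _ _ _ _)) (ht _ _ _ _))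
    (ht _ _ _ _)) (ht _ _ _ _)) (ht _ _ _ _)

/-- The one-parameter group of transvections. -/
def transvectionHom {F : Type*} [CommRing F] {i j : ι} (hij : i ≠ j) :
    Multiplicative F →* SpecialLinearGroup ι F where
  toFun q := SpecialLinearGroup.transvection hij q.toAdd
  map_one' := transvection_coeff_zero hij
  map_mul' a b := transvection_add hij a.toAdd b.toAdd

theorem transvection_zsmul {F : Type*} [CommRing F] {i j : ι} (hij : i ≠ j) (m : ℤ) (q : F) :
    SpecialLinearGroup.transvection hij (m • q) = SpecialLinearGroup.transvection hij q ^ m :=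
  map_zpow (transvectionHom hij) (Multiplicative.ofAdd q) m

theorem diag2n_mul_transvection {F : Type*} [Field F] {i j : ι} (hij : i ≠ j) (a : F)
    (ha : a ≠ 0) (b : F) :
    diag2n hij a ha * SpecialLinearGroup.transvection hij b =
      SpecialLinearGroup.transvection hij (a * a * b) * diag2n hij a ha := by
  refine Subtype.ext ?_
  change (diag2n hij a ha).1 * (1 + single i j b) =
    (1 + single i j (a * a * b)) * (diag2n hij a ha).1
  rw [diag2n_coe, mul_add, add_mul, one_mul, mul_one]
  congr 1
  ext k l
  rw [diagonal_mul, mul_diagonal]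
  by_cases hkl : i = k ∧ j = l
  · obtain ⟨rfl, rfl⟩ := hkl
    rw [single_apply_same, single_apply_same, if_pos rfl, if_neg hij.symm, if_pos rfl]
    field_simp
  · rw [single_apply_of_ne _ _ _ _ _ hkl, single_apply_of_ne _ _ _ _ _ hkl, mul_zero, zero_mul]

/-- A normal subgroup of `SL_n(ℚ)` that contains the elementary matrices with entry `1` is the whole
group. -/
theorem eq_top_of_transvection_one_mem [Nontrivial ι] (N : Subgroup (SpecialLinearGroup ι ℚ))
    [N.Normal]
    (h : ∀ (i j : ι) (hij : i ≠ j), SpecialLinearGroup.transvection hij (1 : ℚ) ∈ N) : N = ⊤ := by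
  refine (Subgroup.eq_top_iff' N).2 fun g => ?_
  refine specialLinearGroup_transvection_induction (· ∈ N) (fun i j hij c => ?_)
    (fun _ _ => N.mul_mem) g
  have hden : (c.den : ℚ) ≠ 0 := Nat.cast_ne_zero.2 c.den_nz
  -- The transvection with entry `1 / den²` is the conjugate of the one with entry `1` by the
  -- diagonal matrix with entries `1 / den` and `den`; its power with exponent `num * den` has entry
  -- `c`.
  have hc : c = (c.num * c.den) • ((c.den : ℚ)⁻¹ * (c.den : ℚ)⁻¹ * 1) := by
    rw [zsmul_eq_mul]
    push_cast
    field_simp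
    exact (Rat.mul_den_eq_num c)
  rw [hc, transvection_zsmul]
  refine N.zpow_mem ?_ _
  rw [← mul_inv_eq_of_eq_mul (diag2n_mul_transvection hij _ (inv_ne_zero hden) 1)]
  exact Subgroup.Normal.conj_mem ‹_› _ (h i j hij) _

end specialLinear

/-! ### Nielsen automorphisms and the map to `SL_n(ℤ)` -/

section SAut

/-- The endomorphism of `F_n` that multiplies `x_j` on the left by `w` and fixes the other
generators. -/
def leftMulGenerator {n : ℕ} (j : Fin n) (w : FreeGroup (Fin n)) :
    FreeGroup (Fin n) →* FreeGroup (Fin n) :=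
  FreeGroup.lift fun k => if k = j then w * FreeGroup.of j else FreeGroup.of k

/-- The Nielsen automorphism `x_j ↦ x_i x_j` of `F_n`. -/
def nielsen {n : ℕ} {i j : Fin n} (hij : i ≠ j) : MulAut (FreeGroup (Fin n)) :=
  MonoidHom.toMulEquiv (leftMulGenerator j (FreeGroup.of i))
    (leftMulGenerator j (FreeGroup.of i)⁻¹)
    (by
      ext k
      by_cases hk : k = j <;> simp [leftMulGenerator, hk, hij])
    (by
      ext k
      by_cases hk : k = j <;> simp [leftMulGenerator, hk, hij])

theorem autAbelianization_nielsen {n : ℕ} {i j : Fin n} (hij : i ≠ j) :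
    autAbelianization n (nielsen hij) = Matrix.transvection i j 1 := by
  ext k l
  change (exponentSum n k (leftMulGenerator j (FreeGroup.of i) (FreeGroup.of l))).toAdd = _
  by_cases hl : l = j
  · subst hl
    simp [leftMulGenerator, exponentSum, Matrix.transvection, Matrix.one_apply,
      Matrix.single_apply, eq_comm, add_comm]
  · simp [leftMulGenerator, exponentSum, Matrix.transvection, Matrix.one_apply, hl, Ne.symm hl]

/-- The action of `SAut(F_n)` on the abelianization of `F_n`. -/
def sautToSpecialLinear (n : ℕ) : SAut n →* Matrix.SpecialLinearGroup (Fin n) ℤ where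
  toFun φ := ⟨autAbelianization n φ, φ.2⟩
  map_one' := Subtype.ext (map_one (autAbelianization n))
  map_mul' φ ψ := Subtype.ext (map_mul (autAbelianization n) φ.1 ψ.1)

/-- Nielsen automorphisms lift the elementary matrices. Surjectivity onto `SL_n(ℤ)` is not needed,
because only these matrices have to act trivially. -/
theorem exists_sautToSpecialLinear_eq {n : ℕ} {i j : Fin n} (hij : i ≠ j) :
    ∃ φ, sautToSpecialLinear n φ = Matrix.SpecialLinearGroup.transvection hij 1 := by
  have h := autAbelianization_nielsen hij
  refine ⟨⟨nielsen hij, ?_⟩, Subtype.ext h⟩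
  change (autAbelianization n (nielsen hij)).det = 1
  rw [h, Matrix.det_transvection_of_ne i j hij]

end SAut

/-! ### The induced action on homology and the conclusion -/

/-- The action on homology that is induced by an action by homeomorphisms. -/
def homologyAction {G : Type*} [Group G] {M : Type u} [TopologicalSpace M] (ρ : G →* (M ≃ₜ M))
    (i : ℕ) : G →* AddMonoid.End (((AlgebraicTopology.singularHomologyFunctor
      (ModuleCat.{u} ℤ) i).obj (ModuleCat.of ℤ (ULift.{u} ℤ))).obj (TopCat.of M)) where
  toFun g := (((AlgebraicTopology.singularHomologyFunctor (ModuleCat.{u} ℤ) i).obj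
    (ModuleCat.of ℤ (ULift.{u} ℤ))).map
      (TopCat.ofHom (ρ g : C(M, M)))).hom.toAddMonoidHom
  map_one' := by
    rw [map_one]
    have h : TopCat.ofHom ((1 : M ≃ₜ M) : C(M, M)) = 𝟙 (TopCat.of M) := rfl
    rw [h, CategoryTheory.Functor.map_id]
    rfl
  map_mul' g h := by
    rw [map_mul]
    have e : TopCat.ofHom ((ρ g * ρ h : M ≃ₜ M) : C(M, M)) =
        TopCat.ofHom (ρ h : C(M, M)) ≫ TopCat.ofHom (ρ g : C(M, M)) := rfl
    rw [e, CategoryTheory.Functor.map_comp]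
    rfl

/-- `SL_n(ℚ)` acts trivially on the homology of a compact manifold. -/
theorem homologicallyTrivial_of_specialLinear_rat {k : ℕ} {M : Type u} [TopologicalSpace M]
    [T2Space M] [CompactSpace M] [ChartedSpace (EuclideanSpace ℝ (Fin k)) M] {n : ℕ}
    (hn : 2 ≤ n) (ρ : Matrix.SpecialLinearGroup (Fin n) ℚ →* (M ≃ₜ M))
    (g : Matrix.SpecialLinearGroup (Fin n) ℚ) : HomologicallyTrivial (ρ g) := by
  intro i
  have : Nontrivial (Fin n) := Fin.nontrivial_iff_two_le.2 hn
  have hfin := finite_singularHomology (k := k) M i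
  -- The `ℤ`-module structure of the object of `ModuleCat` must be traded for the one of the
  -- underlying abelian group; any two such structures are equal.
  have hfin' : @Module.Finite ℤ (((AlgebraicTopology.singularHomologyFunctor
      (ModuleCat.{u} ℤ) i).obj (ModuleCat.of ℤ (ULift.{u} ℤ))).obj (TopCat.of M)) _ _
        (AddCommGroup.toIntModule _) := by
    convert hfin
    exact Subsingleton.elim _ _
  have h : homologyAction ρ i g = 1 := by
    refine specialLinearGroup_transvection_induction (fun g => homologyAction ρ i g = 1)
      (fun a b hab c => ?_) (fun A B hA hB => by rw [map_mul, hA, hB, one_mul]) g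
    exact rat_action_trivial ((homologyAction ρ i).comp (transvectionHom hab))
      (Multiplicative.ofAdd c)
  exact ModuleCat.hom_ext (LinearMap.ext fun x => DFunLike.congr_fun h x)

end

theorem mainTheorem8 {k : ℕ} {M : Type u} [TopologicalSpace M] [T2Space M] [CompactSpace M]
    [ChartedSpace (EuclideanSpace ℝ (Fin k)) M]
    (hM : ConjectureSAut k M ∨ ConjectureSLZ k M)
    (n : ℕ) (hn : k + 1 < n)
    (ρ : Matrix.SpecialLinearGroup (Fin n) ℚ →* (M ≃ₜ M)) :
    IsTrivialAction ρ := by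
  have hn2 : 2 ≤ n := by omega
  have : Nontrivial (Fin n) := Fin.nontrivial_iff_two_le.2 hn2
  have htriv := homologicallyTrivial_of_specialLinear_rat (k := k) hn2 ρ
  have hmap : ∀ (i j : Fin n) (hij : i ≠ j),
      Matrix.SpecialLinearGroup.map (Int.castRingHom ℚ)
        (Matrix.SpecialLinearGroup.transvection hij 1) =
          Matrix.SpecialLinearGroup.transvection hij 1 := fun i j hij => by
    ext a b
    simp [Matrix.SpecialLinearGroup.transvection_coe, Matrix.one_apply, Matrix.single_apply]
  have hker : ρ.ker = ⊤ := by
    refine eq_top_of_transvection_one_mem _ fun i j hij => ?_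
    rw [MonoidHom.mem_ker]
    ext x
    rw [← hmap i j hij]
    -- The conjecture is applied to the pullback of `ρ`, which is homologically trivial because `ρ`
    -- is.
    rcases hM with h | h
    · obtain ⟨φ, hφ⟩ := exists_sautToSpecialLinear_eq hij
      rw [← hφ]
      exact h n hn ((ρ.comp (Matrix.SpecialLinearGroup.map (Int.castRingHom ℚ))).comp
        (sautToSpecialLinear n)) (fun _ => htriv _) φ x
    · exact h n hn (ρ.comp (Matrix.SpecialLinearGroup.map (Int.castRingHom ℚ)))
        (fun _ => htriv _) _ x
  intro g x
  have h : ρ g = 1 := (MonoidHom.mem_ker).1 (hker ▸ Subgroup.mem_top g)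
  rw [h]
  rfl
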